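/- Let $P$ be a function of $\rho>0$ with $P>0$, $dP/d\rho>0$ and $P=\mathsf A\rho^{\gamma}\bigl(1+\Lambda(\rho^{\gamma-1})\bigr)$ for $\rho>0$, where $\mathsf A>0$, $1<\gamma<2$ and $\Lambda\in C^\infty(\mathbb R)$ satisfies $\Lambda(0)=0$. For $h>0$ let $\mathsf f(h)$ be the density $\rho>0$ whose enthalpy $\int_0^{\rho}\frac{1}{s}\frac{dP}{d\rho}(s)\,ds$ equals $h$, and put $\mathsf f(h)=0$ for $h\le 0$. Let $\mathsf G>0$ and $$\mathcal K f(x)=\frac1{4\pi}\int_{\mathbb R^3}\frac{f(y)}{\|x-y\|}\,dy .$$ Let $R>0$, $0<\alpha<1$, and let $u\in C^{2,\alpha}([0,\infty))\cap C^\infty([0,R))$ be such that $u(r)>0\Leftrightarrow r<R$ for all $r\ge 0$, $u'(r)<0$ for all $r>0$, and $\rho(x)=\mathsf f(u(\|x\|))$ is the density of an equilibrium of the Euler--Poisson equations with zero velocity, that is, $\operatorname{grad}P(\rho)+\rho\operatorname{grad}\Phi=0$ in $B_R=\{x\in\mathbb R^3:\|x\|<R\}$ with $\Phi=-4\pi\mathsf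 G\,\mathcal K\rho$. Let $\mathfrak H=L^2(B_R,\rho\,dx;\mathbb C^3)$. Then $$\mathbf L\xi=\operatorname{grad}\Bigl(-\frac1\rho\frac{dP}{d\rho}\operatorname{div}(\rho\xi)+4\pi\mathsf G\,\mathcal K\operatorname{div}(\rho\xi)\Bigr),\qquad \xi\in C_0^\infty(B_R;\mathbb C^3),$$ is a well-defined linear operator $\mathfrak A$ in $\mathfrak H$, densely defined with domain $C_0^\infty(B_R;\mathbb C^3)$, which is symmetric and bounded from below: there is a constant $C$ with $(\mathbf L\xi|\xi)_{\mathfrak H}\ge -C\|\xi\|_{\mathfrak H}^2$ for all $\xi\in C_0^\infty(B_R;\mathbb C^3)$. Its Friedrichs extension, that is, the restriction of the adjoint $\mathfrak A^*$ to those $\xi\in\mathsf D(\mathfrak A^*)$ for which there are $\varphi_n\in C_0^\infty(B_R;\mathbb C^3)$ with $\varphi_n\to\xi$ in $\mathfrak H$ and $(\mathbf L(\varphi_m-\varphi_n)|\varphi_m-\varphi_n)_{\mathfrak H}\to0$ as $m,n\to\infty$, extends $\mathfrak A$ and is a self-adjoint operator in $\mathfrak H$ that is bounded from below. -/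

import Mathlib

open MeasureTheory Filter Topology Set
open scoped ContDiff ENNReal InnerProductSpace

noncomputable section

/-- Physical space `ℝ³`. -/
abbrev Space : Type := EuclideanSpace ℝ (Fin 3)

/-- Values `ℂ³` of the vector fields. -/
abbrev CVec : Type := EuclideanSpace ℂ (Fin 3)

/-- The ball `B_R`. -/
def openBall (R : ℝ) : TopologicalSpace.Opens Space := ⟨Metric.ball 0 R, Metric.isOpen_ball⟩

/-- The Newtonian potential `𝒦 f (x) = (1 / 4π) ∫ f(y) / ‖x - y‖ dy`. -/
def newton {F : Type*} [NormedAddCommGroup F] [NormedSpace ℝ F] (f : Space → F) (x : Space) : F :=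
  (4 * Real.pi)⁻¹ • ∫ y, ‖x - y‖⁻¹ • f y

/-- The partial derivative in the `i`-th coordinate. -/
def partialDeriv {F : Type*} [NormedAddCommGroup F] [NormedSpace ℝ F] (i : Fin 3) (f : Space → F)
    (x : Space) : F :=
  fderiv ℝ f x (EuclideanSpace.single i 1)

/-- The gradient of a complex valued function. -/
def cgrad (f : Space → ℂ) (x : Space) : CVec :=
  WithLp.toLp 2 fun i => partialDeriv i f x

/-- The divergence of a complex vector field. -/
def cdiv (v : Space → CVec) (x : Space) : ℂ :=
  ∑ i, partialDeriv i (fun y => v y i) x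

/-- Assumption (A): the barotropic pressure law `P = A ρ^γ (1 + Λ(ρ^(γ-1)))`. -/
structure BarotropicLaw (P : ℝ → ℝ) (A γ : ℝ) (Λ : ℝ → ℝ) : Prop where
  A_pos : 0 < A
  one_lt_gamma : 1 < γ
  gamma_lt_two : γ < 2
  Lambda_smooth : ContDiff ℝ ∞ Λ
  Lambda_zero : Λ 0 = 0
  eq : ∀ s, 0 < s → P s = A * s ^ γ * (1 + Λ (s ^ (γ - 1)))
  pos : ∀ s, 0 < s → 0 < P s
  deriv_pos : ∀ s, 0 < s → 0 < deriv P s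

/-- The enthalpy `∫_0^s dP / ρ` at density `s`. -/
def enthalpy (P : ℝ → ℝ) (s : ℝ) : ℝ := ∫ t in (0 : ℝ)..s, deriv P t / t

/-- `s = f(h)`: the density `s` that belongs to the value `h` of the enthalpy variable, namely
the positive density with enthalpy `h` if `h > 0`, and vacuum if `h ≤ 0`. -/
def IsDensityAt (P : ℝ → ℝ) (h s : ℝ) : Prop :=
  (0 < h → 0 < s ∧ enthalpy P s = h) ∧ (h ≤ 0 → s = 0)

/-- The gravitational potential `Φ = -4πG 𝒦 ρ`. -/
def gravPotential (G : ℝ) (ρ : Space → ℝ) (x : Space) : ℝ := -(4 * Real.pi * G) * newton ρ x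

/-- Assumption (S): `ρ`, with velocity `0`, is a spherically symmetric equilibrium
whose enthalpy profile is `u` and whose radius is `R`. -/
structure SphericalEquilibrium (P : ℝ → ℝ) (G : ℝ) (u : ℝ → ℝ) (ρ : Space → ℝ) (R α : ℝ) :
    Prop where
  R_pos : 0 < R
  alpha_pos : 0 < α
  alpha_lt_one : α < 1
  /-- `ρ(x) = f(u(‖x‖))` -/
  density : ∀ x, IsDensityAt P (u ‖x‖) (ρ x)
  /-- `u ∈ C²([0, ∞))` -/
  contDiff_two : ContDiffOn ℝ 2 u (Ici 0)
  /-- `u''` is (locally) `α`-Hölder on `[0, ∞)` -/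
  holder : ∀ b, ∃ C, ∀ s ∈ Icc 0 b, ∀ t ∈ Icc 0 b,
    |iteratedDerivWithin 2 u (Ici 0) s - iteratedDerivWithin 2 u (Ici 0) t| ≤ C * |s - t| ^ α
  /-- `u ∈ C^∞([0, R))` -/
  smooth : ContDiffOn ℝ ∞ u (Ico 0 R)
  pos_iff : ∀ r, 0 ≤ r → (0 < u r ↔ r < R)
  deriv_neg : ∀ r, 0 < r → deriv u r < 0
  /-- the stationary momentum equation `grad P + ρ grad Φ = 0` where `ρ > 0` -/
  differentiableAt_pressure : ∀ x ∈ openBall R, DifferentiableAt ℝ (fun y => P (ρ y)) x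
  differentiableAt_potential : ∀ x ∈ openBall R, DifferentiableAt ℝ (gravPotential G ρ) x
  momentum : ∀ x ∈ openBall R,
    gradient (fun y => P (ρ y)) x + ρ x • gradient (gravPotential G ρ) x = 0

/-- The measure `ρ dx` on `B_R`. -/
def weightedMeasure (ρ : Space → ℝ) (R : ℝ) : Measure Space :=
  (volume.restrict (openBall R : Set Space)).withDensity fun x => ENNReal.ofReal (ρ x)

/-- The Hilbert space `𝔥 = L²(B_R, ρ dx; ℂ³)`. -/
abbrev WeightedL2 (ρ : Space → ℝ) (R : ℝ) : Type := Lp CVec 2 (weightedMeasure ρ R)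

/-- `L ξ = grad(-(1/ρ)(dP/dρ) div(ρ ξ) + 4πG 𝒦 div(ρ ξ))`. -/
def stellarL (P : ℝ → ℝ) (G : ℝ) (ρ : Space → ℝ) (ξ : Space → CVec) : Space → CVec :=
  cgrad fun x =>
    -(((1 / ρ x) * deriv P (ρ x) : ℝ) : ℂ) * cdiv (fun y => ρ y • ξ y) x
      + ((4 * Real.pi * G : ℝ) : ℂ) * newton (cdiv fun y => ρ y • ξ y) x

/-- `T` is the operator in `𝔥` with domain `C₀^∞(B_R; ℂ³)` that maps `ξ` to `L ξ`. -/
def IsStellarOperator (P : ℝ → ℝ) (G : ℝ) (ρ : Space → ℝ) (R : ℝ)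
    (T : WeightedL2 ρ R →ₗ.[ℂ] WeightedL2 ρ R) : Prop :=
  ∀ p : WeightedL2 ρ R × WeightedL2 ρ R, p ∈ T.graph ↔
    ∃ ξ : TestFunction (openBall R) CVec ⊤,
      p.1 =ᵐ[weightedMeasure ρ R] ξ ∧ p.2 =ᵐ[weightedMeasure ρ R] stellarL P G ρ ξ

section Abstract

variable {H : Type*} [NormedAddCommGroup H] [InnerProductSpace ℂ H]

/-- `(T x | x) ≥ -C ‖x‖²` on the domain of `T`. -/
def IsBoundedBelow (T : H →ₗ.[ℂ] H) : Prop :=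
  ∃ C : ℝ, ∀ x : T.domain, -C * ‖(x : H)‖ ^ 2 ≤ (⟪T x, (x : H)⟫_ℂ).re

/-- The domain of the closure of the quadratic form `q[x] = (T x | x)`: the limits of the sequences
`xₙ` in the domain of `T` such that `q[xₘ - xₙ] → 0`. -/
def closedFormDomain (T : H →ₗ.[ℂ] H) : Set H :=
  {y | ∃ x : ℕ → T.domain, Tendsto (fun n => (x n : H)) atTop (𝓝 y) ∧
    Tendsto (fun p : ℕ × ℕ => ⟪T (x p.1 - x p.2), ((x p.1 - x p.2 : T.domain) : H)⟫_ℂ)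
      atTop (𝓝 0)}

/-- `S` is the Friedrichs extension of the (densely defined, symmetric, semibounded) operator `T`:
the restriction of the adjoint of `T` to those elements of its domain that lie in
the domain of the closed form of `T`. -/
def IsFriedrichsExtension [CompleteSpace H] (T S : H →ₗ.[ℂ] H) : Prop :=
  S ≤ T.adjoint ∧ (S.domain : Set H) = closedFormDomain T ∩ (T.adjoint.domain : Set H)

end Abstract

end

/-! In `L²(ρ dx)` the weight can be moved onto the second field, so integration by parts gives the
form (Lξ|η) = ∫ (1/ρ)(dP/dρ) conj(div ρξ) div ρη - 4πG ∫ conj(div ρξ) 𝒦(div ρη)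
(`inner_stellarGraphMap`). The first term is hermitian and nonnegative, the second hermitian because
the Newtonian kernel is symmetric; this gives symmetry.

For the lower bound, 𝒦 inverts -Δ, so it multiplies Fourier transforms by 1/(4π²|k|²), while div v
has transform 2πi k·v̂. The factors |k|² cancel and ∫ conj(div v) 𝒦(div v) ≤ ∫ |v|²
(`re_integral_conj_cdiv_mul_newton_le`). With v = ρξ and ρ ≤ ρ(0) the form is at least -4πGρ(0)‖ξ‖².
To avoid Fourier transforms of the singular kernel, π/‖w‖ is written as an integral of Gaussians
over their width parameter; one half of Plancherel's theorem is then enough.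

For L to make sense, ρ has to be C² in the ball, also at the centre. This needs u'(0) = 0, which
differentiability of the pressure at the origin forces (`SphericalEquilibrium.derivWithin_zero`).
Then Lξ is continuous, hence square integrable for the finite measure ρ dx.

The rest is Friedrichs' abstract theorem. The form domain is completed to a Hilbert space V with a
bounded map J to H. The restriction of the adjoint to the range of J, shifted by c, has the
everywhere defined symmetric inverse J J*, which makes it self-adjoint. -/

/-! ### Friedrichs' theorem for semibounded symmetric operators. -/

section Friedrichs

theorem re_ofReal_mul_inner_self {H : Type*} [NormedAddCommGroup H] [InnerProductSpace ℂ H]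
    (c : ℝ) (x : H) : ((c : ℂ) * ⟪x, x⟫_ℂ).re = c * ‖x‖ ^ 2 := by
  rw [Complex.re_ofReal_mul, ← inner_self_eq_norm_sq (𝕜 := ℂ) x]
  rfl

theorem tendsto_sub_zero_of_tendsto {F : Type*} [NormedAddCommGroup F] {f : ℕ → F} {a : F}
    (hf : Tendsto f atTop (𝓝 a)) :
    Tendsto (fun p : ℕ × ℕ => f p.1 - f p.2) atTop (𝓝 0) := by
  have h1 : Tendsto (fun p : ℕ × ℕ => f p.1) atTop (𝓝 a) := by
    rw [← prod_atTop_atTop_eq]; exact hf.comp tendsto_fst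
  have h2 : Tendsto (fun p : ℕ × ℕ => f p.2) atTop (𝓝 a) := by
    rw [← prod_atTop_atTop_eq]; exact hf.comp tendsto_snd
  simpa using h1.sub h2

variable {H : Type*} [NormedAddCommGroup H] [InnerProductSpace ℂ H]

/-- If the form domain of `T` is realized as the range of a bounded map `J` on a Hilbert
space `V` whose inner product extends the form `⟪T x, y⟫ + c ⟪x, y⟫`, then the closed form domain
of `T` is the range of `J`. -/
theorem closedFormDomain_eq_range {V : Type*} [NormedAddCommGroup V] [InnerProductSpace ℂ V]
    [CompleteSpace V] {T : H →ₗ.[ℂ] H} (J : V →L[ℂ] H) (i : T.domain →ₗ[ℂ] V)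
    (hi : DenseRange i) (hJ : ∀ x, J (i x) = x) (c : ℝ)
    (hB : ∀ x y, ⟪i x, i y⟫_ℂ = ⟪T x, (y : H)⟫_ℂ + c * ⟪(x : H), (y : H)⟫_ℂ) :
    closedFormDomain T = Set.range J := by
  ext y
  constructor
  · rintro ⟨x, hx, hq⟩
    have hx2 : Tendsto (fun p : ℕ × ℕ => ((x p.1 - x p.2 : T.domain) : H)) atTop (𝓝 0) := by
      simpa using tendsto_sub_zero_of_tendsto hx
    have hsq : Tendsto (fun p : ℕ × ℕ => ‖i (x p.1) - i (x p.2)‖ ^ 2) atTop (𝓝 0) := by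
      -- The form alone may be negative; adding c‖·‖², which tends to 0 along the sequence, turns it
      -- into the squared norm of V.
      have h3 : Tendsto (fun p : ℕ × ℕ => ⟪i (x p.1 - x p.2), i (x p.1 - x p.2)⟫_ℂ) atTop
          (𝓝 0) := by
        simp_rw [hB]
        have := hq.add ((hx2.inner hx2 (𝕜 := ℂ)).const_mul (c : ℂ))
        simpa using this
      have h4 := h3.norm
      simp only [norm_zero] at h4
      refine h4.congr fun p => ?_
      rw [inner_self_eq_norm_sq_to_K, ← map_sub]
      simp
    have hn : Tendsto (fun p : ℕ × ℕ => dist (i (x p.1)) (i (x p.2))) atTop (𝓝 0) := by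
      have := hsq.sqrt
      simpa [Real.sqrt_sq, dist_eq_norm] using this
    have hc : CauchySeq fun n => i (x n) := by
      rw [Metric.cauchySeq_iff]
      intro ε hε
      have h5 := (tendsto_order.1 hn).2 ε hε
      rw [eventually_atTop] at h5
      obtain ⟨⟨a, b⟩, hab⟩ := h5
      refine ⟨max a b, fun m hm n hn => hab (m, n) ⟨?_, ?_⟩⟩
      · exact (le_max_left _ _).trans hm
      · exact (le_max_right _ _).trans hn
    obtain ⟨v, hv⟩ := cauchySeq_tendsto_of_complete hc
    refine ⟨v, tendsto_nhds_unique ((J.continuous.tendsto v).comp hv) ?_⟩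
    simpa [Function.comp_def, hJ] using hx
  · rintro ⟨v, rfl⟩
    obtain ⟨w, hw, hwv⟩ := mem_closure_iff_seq_limit.1 (hi v)
    choose x hx using hw
    have hxv : Tendsto (fun n => i (x n)) atTop (𝓝 v) := by simpa [hx] using hwv
    have hJx : Tendsto (fun n => (x n : H)) atTop (𝓝 (J v)) := by
      simpa [Function.comp_def, hJ] using (J.continuous.tendsto v).comp hxv
    refine ⟨x, hJx, ?_⟩
    have h1 := tendsto_sub_zero_of_tendsto hxv
    have h2 : Tendsto (fun p : ℕ × ℕ => ((x p.1 - x p.2 : T.domain) : H)) atTop (𝓝 0) := by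
      simpa using tendsto_sub_zero_of_tendsto hJx
    have h3 := (h1.inner h1 (𝕜 := ℂ)).sub ((h2.inner h2 (𝕜 := ℂ)).const_mul (c : ℂ))
    simp only [inner_zero_left, mul_zero, sub_zero] at h3
    refine h3.congr fun p => ?_
    rw [← map_sub, hB]
    ring

variable [CompleteSpace H]

/-- Friedrichs' theorem, for a symmetric operator whose form domain is realized as the range of
a bounded map `J` on a Hilbert space `V`. -/
theorem exists_isFriedrichsExtension_of_form {V : Type*} [NormedAddCommGroup V]
    [InnerProductSpace ℂ V] [CompleteSpace V] {T : H →ₗ.[ℂ] H}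
    (hd : Dense (T.domain : Set H)) (hs : T.IsFormalAdjoint T)
    (J : V →L[ℂ] H) (i : T.domain →ₗ[ℂ] V)
    (hi : DenseRange i) (hJ : ∀ x, J (i x) = x) (c : ℝ)
    (hB : ∀ x y, ⟪i x, i y⟫_ℂ = ⟪T x, (y : H)⟫_ℂ + c * ⟪(x : H), (y : H)⟫_ℂ) :
    ∃ L : H →ₗ.[ℂ] H,
      IsFriedrichsExtension T L ∧ T ≤ L ∧ IsSelfAdjoint L ∧ IsBoundedBelow L := by
  let J' : H →L[ℂ] V := ContinuousLinearMap.adjoint J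
  have hJ' : ∀ v h, ⟪J' h, v⟫_ℂ = ⟪h, J v⟫_ℂ := fun v h => J.adjoint_inner_left v h
  have hJ'r : ∀ v h, ⟪v, J' h⟫_ℂ = ⟪J v, h⟫_ℂ := fun v h => J.adjoint_inner_right v h
  -- The form identity passes to all of V by density. Closability is contained in it: if J v = 0,
  -- then v is orthogonal to the dense range of `i`.
  have hext : ∀ v (x : T.domain), ⟪v, i x⟫_ℂ = ⟪J v, T x + c • (x : H)⟫_ℂ := by
    intro v x
    refine hi.induction_on (p := fun v => ⟪v, i x⟫_ℂ = ⟪J v, T x + c • (x : H)⟫_ℂ) v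
      (isClosed_eq (by fun_prop) (by fun_prop)) fun y => ?_
    rw [hB, hJ, inner_add_right, hs y x, inner_smul_right_eq_smul]
    simp
  let L : H →ₗ.[ℂ] H := T.adjoint.domRestrict (LinearMap.range (J : V →ₗ[ℂ] H))
  have hLle : L ≤ T.adjoint := LinearPMap.domRestrict_le
  have hLd : (L.domain : Set H) = closedFormDomain T ∩ (T.adjoint.domain : Set H) := by
    rw [closedFormDomain_eq_range J i hi hJ c hB]
    rfl
  have hLadj : ∀ (z : L.domain) (x : T.domain), ⟪L z, (x : H)⟫_ℂ = ⟪(z : H), T x⟫_ℂ := by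
    intro z x
    have hz : (z : H) ∈ T.adjoint.domain := z.2.2
    have h1 : L z = T.adjoint ⟨z, hz⟩ := LinearPMap.domRestrict_apply rfl
    rw [h1]
    exact LinearPMap.adjoint_isFormalAdjoint hd ⟨z, hz⟩ x
  -- Together with `hsurj` this says that J J* is the inverse of L + c, defined on all of H.
  have hres : ∀ z : L.domain, (z : H) = J (J' (L z + c • (z : H))) := by
    intro z
    obtain ⟨v, hv⟩ := z.2.1
    have hv' : J v = z := hv
    have : v = J' (L z + c • (z : H)) := by
      refine ext_inner_right ℂ fun w => ?_
      refine hi.induction_on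
        (p := fun w => ⟪v, w⟫_ℂ = ⟪J' (L z + c • (z : H)), w⟫_ℂ) w
        (isClosed_eq (by fun_prop) (by fun_prop)) fun x => ?_
      rw [hext, hJ', hJ, hv', inner_add_left, inner_add_right, hLadj, inner_smul_left_eq_smul,
        inner_smul_right_eq_smul]
    rw [← this, hv']
  have hsurj : ∀ h : H, ∃ z : L.domain, (z : H) = J (J' h) ∧ L z + c • (z : H) = h := by
    intro h
    have hK : ∀ x : T.domain, ⟪h - c • J (J' h), (x : H)⟫_ℂ = ⟪J (J' h), T x⟫_ℂ := by
      intro x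
      have h1 := hext (J' h) x
      rw [hJ', hJ, inner_add_right, inner_smul_right_eq_smul] at h1
      rw [inner_sub_left, h1, inner_smul_left_eq_smul]
      abel
    have hmem : J (J' h) ∈ T.adjoint.domain :=
      LinearPMap.mem_adjoint_domain_of_exists _ ⟨_, hK⟩
    refine ⟨⟨J (J' h), ⟨⟨J' h, rfl⟩, hmem⟩⟩, rfl, ?_⟩
    have h1 : L ⟨J (J' h), ⟨⟨J' h, rfl⟩, hmem⟩⟩ = T.adjoint ⟨J (J' h), hmem⟩ :=
      LinearPMap.domRestrict_apply rfl
    rw [h1, LinearPMap.adjoint_apply_eq hd ⟨J (J' h), hmem⟩ hK]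
    abel
  have hsymm : L.IsFormalAdjoint L := by
    intro y z
    have h1 : ⟪L y + c • (y : H), (z : H)⟫_ℂ = ⟪(y : H), L z + c • (z : H)⟫_ℂ := by
      conv_lhs => rw [hres z]
      conv_rhs => rw [hres y]
      rw [← hJ', ← hJ'r]
    rw [inner_add_left, inner_add_right, inner_smul_left_eq_smul, inner_smul_right_eq_smul] at h1
    exact add_right_cancel h1
  have hTL : T ≤ L := by
    have hTa : T ≤ T.adjoint := hs.le_adjoint hd
    refine ⟨fun x hx => ⟨⟨i ⟨x, hx⟩, hJ _⟩, hTa.1 hx⟩, fun x z hxz => ?_⟩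
    have hz : (z : H) ∈ T.adjoint.domain := z.2.2
    have h1 : L z = T.adjoint ⟨z, hz⟩ := LinearPMap.domRestrict_apply rfl
    rw [h1]
    exact hTa.2 hxz
  have hLdense : Dense (L.domain : Set H) := hd.mono hTL.1
  refine ⟨L, ⟨hLle, hLd⟩, hTL, ?_, ?_⟩
  · rw [LinearPMap.isSelfAdjoint_def]
    refine le_antisymm ?_ (hsymm.le_adjoint hLdense)
    -- For z in the domain of L*, solve (L + c)z' = (L* + c)z. Then z - z' is orthogonal to the
    -- range of L + c, which is H, so z = z' lies in the domain of L.
    have hsub : ∀ z : L.adjoint.domain, ∃ z' : L.domain, (z' : H) = z ∧ L z' = L.adjoint z := by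
      intro z
      obtain ⟨z', hz', hLz'⟩ := hsurj (L.adjoint z + c • (z : H))
      have heq : (z' : H) = z := by
        refine ext_inner_right ℂ fun h => ?_
        obtain ⟨y, hy, hLy⟩ := hsurj h
        have h1 := LinearPMap.adjoint_isFormalAdjoint hLdense z y
        have h2 := hsymm z' y
        have h3 : ⟪(z : H), h⟫_ℂ = ⟪L.adjoint z + c • (z : H), (y : H)⟫_ℂ := by
          rw [← hLy, inner_add_left, inner_add_right, h1, inner_smul_left_eq_smul,
            inner_smul_right_eq_smul]
        rw [h3, ← hLz', ← hLy, inner_add_left, inner_add_right, h2, inner_smul_left_eq_smul,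
          inner_smul_right_eq_smul]
      refine ⟨z', heq, ?_⟩
      rw [heq] at hLz'
      exact add_right_cancel hLz'
    refine ⟨fun z hz => ?_, fun z y hzy => ?_⟩
    · obtain ⟨z', h1, -⟩ := hsub ⟨z, hz⟩
      have h2 : (z' : H) = z := h1
      rw [← h2]
      exact z'.2
    · obtain ⟨z', h1, h2⟩ := hsub z
      have : z' = y := Subtype.ext (h1.trans hzy)
      rw [← h2, this]
  · refine ⟨c, fun z => ?_⟩
    set h := L z + c • (z : H) with hh
    have h1 : (z : H) = J (J' h) := hres z
    -- Since z = J J* h with h = (L + c)z, the form of L + c is a square, and -c is a lower bound of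
    -- L.
    have h2 : (⟪h, (z : H)⟫_ℂ).re = ‖J' h‖ ^ 2 := by
      rw [h1, ← hJ', inner_self_eq_norm_sq_to_K]
      norm_cast
    have h3 : (⟪h, (z : H)⟫_ℂ).re = (⟪L z, (z : H)⟫_ℂ).re + c * ‖(z : H)‖ ^ 2 := by
      rw [hh, inner_add_left, inner_smul_left_eq_smul, Complex.add_re, Complex.real_smul,
        re_ofReal_mul_inner_self]
    have := sq_nonneg ‖J' h‖
    linarith

/-- The domain of `T`, to be equipped with the inner product of a form. -/
noncomputable def FormSpace (T : H →ₗ.[ℂ] H) : Type _ := T.domain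

/-- Only the algebraic structure is carried over, so that the form norm does not compete with the
norm `T.domain` inherits from H. -/
instance (T : H →ₗ.[ℂ] H) : AddCommGroup (FormSpace T) := inferInstanceAs (AddCommGroup T.domain)

instance (T : H →ₗ.[ℂ] H) : Module ℂ (FormSpace T) := inferInstanceAs (Module ℂ T.domain)

/-- The identification of the domain of `T` with its form space. -/
noncomputable def FormSpace.equiv (T : H →ₗ.[ℂ] H) : T.domain ≃ₗ[ℂ] FormSpace T := LinearEquiv.refl ℂ T.domain

/-- The inner product `⟪T x, y⟫ + c ⟪x, y⟫` on the domain of `T`. -/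
@[reducible]
noncomputable def FormSpace.core {T : H →ₗ.[ℂ] H} (hs : T.IsFormalAdjoint T) (c : ℝ)
    (hc : ∀ x : T.domain, ‖(x : H)‖ ^ 2 ≤ (⟪T x, (x : H)⟫_ℂ).re + c * ‖(x : H)‖ ^ 2) :
    InnerProductSpace.Core ℂ (FormSpace T) where
  inner x y := ⟪T ((FormSpace.equiv T).symm x), ((FormSpace.equiv T).symm y : H)⟫_ℂ +
    c * ⟪((FormSpace.equiv T).symm x : H), ((FormSpace.equiv T).symm y : H)⟫_ℂ
  conj_inner_symm x y := by
    rw [map_add, map_mul, inner_conj_symm, inner_conj_symm, Complex.conj_ofReal, ← hs]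
  re_inner_nonneg x := by
    have h := hc ((FormSpace.equiv T).symm x)
    refine (sq_nonneg ‖((FormSpace.equiv T).symm x : H)‖).trans (h.trans_eq ?_)
    simp only [map_add, RCLike.re_to_complex, re_ofReal_mul_inner_self]
  add_left x y z := by
    simp only [map_add, T.map_add, Submodule.coe_add, inner_add_left]
    ring
  smul_left x y r := by
    simp only [map_smul, T.map_smul, Submodule.coe_smul, inner_smul_left]
    ring
  definite x hx := by
    have h := hc ((FormSpace.equiv T).symm x)
    have h1 := congrArg Complex.re hx
    simp only [Complex.add_re, Complex.zero_re, re_ofReal_mul_inner_self] at h1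
    rw [h1] at h
    have h2 : ‖((FormSpace.equiv T).symm x : H)‖ = 0 := by
      nlinarith [norm_nonneg ((FormSpace.equiv T).symm x : H)]
    rw [norm_eq_zero, Submodule.coe_eq_zero] at h2
    simpa using h2

/-- **Friedrichs' theorem**: the Friedrichs extension of a densely defined symmetric operator that
is bounded from below exists, is self-adjoint and bounded from below. -/
theorem exists_isFriedrichsExtension {T : H →ₗ.[ℂ] H} (hd : Dense (T.domain : Set H))
    (hs : T.IsFormalAdjoint T) (hb : IsBoundedBelow T) :
    ∃ L : H →ₗ.[ℂ] H,
      IsFriedrichsExtension T L ∧ T ≤ L ∧ IsSelfAdjoint L ∧ IsBoundedBelow L := by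
  obtain ⟨C, hC⟩ := hb
  -- The shift C + 1, rather than C, makes the form norm dominate the norm of H. This gives
  -- definiteness and the continuity of the inclusion `j`.
  have hc : ∀ x : T.domain,
      ‖(x : H)‖ ^ 2 ≤ (⟪T x, (x : H)⟫_ℂ).re + (C + 1) * ‖(x : H)‖ ^ 2 := fun x => by
    linarith [hC x]
  let core := FormSpace.core hs (C + 1) hc
  let : NormedAddCommGroup (FormSpace T) := core.toNormedAddCommGroup
  let : InnerProductSpace ℂ (FormSpace T) := InnerProductSpace.ofCore core.toCore
  have hin : ∀ x y : T.domain, ⟪FormSpace.equiv T x, FormSpace.equiv T y⟫_ℂ =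
      ⟪T x, (y : H)⟫_ℂ + ((C + 1 : ℝ) : ℂ) * ⟪(x : H), (y : H)⟫_ℂ := fun x y => rfl
  have hnorm : ∀ x : T.domain, ‖(x : H)‖ ≤ ‖FormSpace.equiv T x‖ := by
    intro x
    refine le_of_sq_le_sq ?_ (norm_nonneg _)
    refine (hc x).trans_eq ?_
    rw [← inner_self_eq_norm_sq (𝕜 := ℂ) (FormSpace.equiv T x), hin]
    simp only [map_add, RCLike.re_to_complex, re_ofReal_mul_inner_self]
  let j : FormSpace T →L[ℂ] H :=
    (T.domain.subtype ∘ₗ ((FormSpace.equiv T).symm : FormSpace T →ₗ[ℂ] T.domain)).mkContinuous 1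
      fun x => by simpa using hnorm ((FormSpace.equiv T).symm x)
  let J : UniformSpace.Completion (FormSpace T) →L[ℂ] H := j.fromCompletion
  let i : T.domain →ₗ[ℂ] UniformSpace.Completion (FormSpace T) :=
    (UniformSpace.Completion.toComplL (𝕜 := ℂ) (E := FormSpace T)).toLinearMap ∘ₗ
      (FormSpace.equiv T : T.domain →ₗ[ℂ] FormSpace T)
  have hi : DenseRange i :=
    UniformSpace.Completion.denseRange_coe.comp (FormSpace.equiv T).surjective.denseRange
      (UniformSpace.Completion.continuous_coe _)
  have hJ : ∀ x, J (i x) = x := fun x =>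
    UniformSpace.Completion.extension_coe j.uniformContinuous _
  have hB : ∀ x y, ⟪i x, i y⟫_ℂ =
      ⟪T x, (y : H)⟫_ℂ + ((C + 1 : ℝ) : ℂ) * ⟪(x : H), (y : H)⟫_ℂ := fun x y =>
    (UniformSpace.Completion.inner_coe _ _).trans (hin x y)
  exact exists_isFriedrichsExtension_of_form hd hs J i hi hJ (C + 1) hB

end Friedrichs

/-! ### Enthalpy and density for the barotropic law. -/

section Barotropic

variable {P : ℝ → ℝ} {A γ : ℝ} {Λ : ℝ → ℝ}

theorem BarotropicLaw.contDiffOn (hP : BarotropicLaw P A γ Λ) : ContDiffOn ℝ ∞ P (Ioi 0) := by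
  have h : ContDiffOn ℝ ∞ (fun s => A * s ^ γ * (1 + Λ (s ^ (γ - 1)))) (Ioi 0) := by
    intro s hs
    have h1 : ∀ p : ℝ, ContDiffAt ℝ ∞ (fun s : ℝ => s ^ p) s := fun p =>
      Real.contDiffAt_rpow_const_of_ne (ne_of_gt hs)
    have h2 : ContDiffAt ℝ ∞ (fun s : ℝ => Λ (s ^ (γ - 1))) s :=
      hP.Lambda_smooth.contDiffAt.comp s (h1 _)
    exact ((contDiffAt_const.mul (h1 γ)).mul (contDiffAt_const.add h2)).contDiffWithinAt
  exact h.congr fun s hs => hP.eq s hs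

theorem BarotropicLaw.hasDerivAt (hP : BarotropicLaw P A γ Λ) {s : ℝ} (hs : 0 < s) :
    HasDerivAt P (deriv P s) s :=
  ((hP.contDiffOn.contDiffAt (Ioi_mem_nhds hs)).differentiableAt (by simp)).hasDerivAt

theorem BarotropicLaw.contDiffOn_deriv (hP : BarotropicLaw P A γ Λ) :
    ContDiffOn ℝ ∞ (deriv P) (Ioi 0) :=
  hP.contDiffOn.deriv_of_isOpen isOpen_Ioi (by simp)

theorem BarotropicLaw.contDiffOn_deriv_div (hP : BarotropicLaw P A γ Λ) :
    ContDiffOn ℝ ∞ (fun s => deriv P s / s) (Ioi 0) :=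
  hP.contDiffOn_deriv.div contDiffOn_id fun _ hs => ne_of_gt hs

/-- Isolates the singularity of the enthalpy integrand at vacuum: t^(γ-2) is integrable at 0 because
γ > 1, and the other factor is continuous up to t = 0 because Λ is smooth there. -/
theorem BarotropicLaw.deriv_div_eq (hP : BarotropicLaw P A γ Λ) {t : ℝ} (ht : 0 < t) :
    deriv P t / t = t ^ (γ - 2) *
      (A * γ * (1 + Λ (t ^ (γ - 1))) + A * (γ - 1) * (t ^ (γ - 1) * deriv Λ (t ^ (γ - 1)))) := by
  have hr : ∀ p : ℝ, HasDerivAt (fun s : ℝ => s ^ p) (p * t ^ (p - 1)) t := fun p =>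
    Real.hasDerivAt_rpow_const (Or.inl ht.ne')
  have hΛ : HasDerivAt Λ (deriv Λ (t ^ (γ - 1))) (t ^ (γ - 1)) :=
    ((hP.Lambda_smooth.differentiable (by simp)) _).hasDerivAt
  have h1 := ((hr γ).const_mul A).mul ((hΛ.comp t (hr (γ - 1))).const_add 1)
  have h2 := (h1.congr_of_eventuallyEq (f₁ := P) (by
    filter_upwards [Ioi_mem_nhds ht] with s hs
    simpa using hP.eq s hs)).deriv
  rw [h2]
  have e1 : t ^ (γ - 1) = t ^ (γ - 2) * t := by
    rw [← Real.rpow_add_one ht.ne']; ring_nf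
  have e2 : t ^ γ = t ^ (γ - 2) * t * t := by
    rw [← Real.rpow_add_one ht.ne', ← Real.rpow_add_one ht.ne']; ring_nf
  have e3 : γ - 1 - 1 = γ - 2 := by ring
  rw [e3, div_eq_iff ht.ne', e2]
  simp only [Function.comp_apply]
  generalize hL : Λ (t ^ (γ - 1)) = a
  generalize hL' : deriv Λ (t ^ (γ - 1)) = b
  rw [e1]
  ring

theorem BarotropicLaw.intervalIntegrable (hP : BarotropicLaw P A γ Λ) {s : ℝ} (hs : 0 ≤ s) :
    IntervalIntegrable (fun t => deriv P t / t) volume 0 s := by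
  have h1 : IntervalIntegrable (fun t : ℝ => t ^ (γ - 2)) volume 0 s :=
    intervalIntegral.intervalIntegrable_rpow' (by linarith [hP.one_lt_gamma])
  have hr : Continuous fun t : ℝ => t ^ (γ - 1) :=
    Real.continuous_rpow_const (by linarith [hP.one_lt_gamma])
  have hΛ : Continuous Λ := hP.Lambda_smooth.continuous
  have hΛ' : Continuous (deriv Λ) := hP.Lambda_smooth.continuous_deriv (by simp)
  have hk : Continuous fun t : ℝ =>
      A * γ * (1 + Λ (t ^ (γ - 1))) + A * (γ - 1) * (t ^ (γ - 1) * deriv Λ (t ^ (γ - 1))) := by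
    fun_prop
  refine (h1.mul_continuousOn hk.continuousOn).congr ?_
  intro t ht
  rw [uIoc_of_le hs] at ht
  exact (hP.deriv_div_eq ht.1).symm

theorem BarotropicLaw.hasDerivAt_enthalpy (hP : BarotropicLaw P A γ Λ) {s : ℝ} (hs : 0 < s) :
    HasDerivAt (enthalpy P) (deriv P s / s) s := by
  have hc : ContinuousOn (fun t => deriv P t / t) (Ioi 0) := hP.contDiffOn_deriv_div.continuousOn
  exact intervalIntegral.integral_hasDerivAt_right (hP.intervalIntegrable hs.le)
    (hc.stronglyMeasurableAtFilter isOpen_Ioi s hs) (hc.continuousAt (Ioi_mem_nhds hs))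

theorem BarotropicLaw.contDiffOn_enthalpy (hP : BarotropicLaw P A γ Λ) :
    ContDiffOn ℝ ∞ (enthalpy P) (Ioi 0) := by
  -- The order ∞ + 1 has the successor form needed to reduce smoothness to that of the derivative.
  have h : ContDiffOn ℝ ((∞ : ℕ∞ω) + 1) (enthalpy P) (Ioi 0) := by
    refine (contDiffOn_succ_iff_deriv_of_isOpen isOpen_Ioi).2 ⟨fun s hs =>
      (hP.hasDerivAt_enthalpy hs).differentiableAt.differentiableWithinAt, by simp, ?_⟩
    exact hP.contDiffOn_deriv_div.congr fun s hs => (hP.hasDerivAt_enthalpy hs).deriv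
  exact h.of_le (by simp)

theorem BarotropicLaw.strictMonoOn_enthalpy (hP : BarotropicLaw P A γ Λ) :
    StrictMonoOn (enthalpy P) (Ioi 0) := by
  refine strictMonoOn_of_deriv_pos (convex_Ioi 0) hP.contDiffOn_enthalpy.continuousOn ?_
  intro s hs
  rw [interior_Ioi] at hs
  rw [(hP.hasDerivAt_enthalpy hs).deriv]
  exact div_pos (hP.deriv_pos s hs) hs

/-- Locally, the density is a smooth function of the enthalpy variable. -/
theorem BarotropicLaw.exists_localInverse (hP : BarotropicLaw P A γ Λ) {h₀ s₀ : ℝ} (hh : 0 < h₀)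
    (hd : IsDensityAt P h₀ s₀) :
    ∃ g : ℝ → ℝ, ContDiffAt ℝ ∞ g h₀ ∧ HasDerivAt g (deriv P s₀ / s₀)⁻¹ h₀ ∧ g h₀ = s₀ ∧
      ∀ᶠ h in 𝓝 h₀, ∀ s, IsDensityAt P h s → s = g h := by
  obtain ⟨hs, hE⟩ := hd.1 hh
  have hc : ContDiffAt ℝ ∞ (enthalpy P) s₀ := hP.contDiffOn_enthalpy.contDiffAt (Ioi_mem_nhds hs)
  have hne : deriv P s₀ / s₀ ≠ 0 := (div_pos (hP.deriv_pos s₀ hs) hs).ne'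
  have hsd : HasStrictDerivAt (enthalpy P) (deriv P s₀ / s₀) s₀ :=
    hc.hasStrictDerivAt' (hP.hasDerivAt_enthalpy hs) (by simp)
  have hf := hsd.hasStrictFDerivAt_equiv hne
  let g := hf.localInverse (enthalpy P) _ s₀
  have hg0 : g h₀ = s₀ := by rw [← hE]; exact hf.localInverse_apply_image
  have hg1 : HasDerivAt g (deriv P s₀ / s₀)⁻¹ h₀ := by
    rw [← hE]; exact (hsd.to_localInverse hne).hasDerivAt
  have hg2 : ContDiffAt ℝ ∞ g h₀ := by
    rw [← hE]; exact hc.to_localInverse hf.hasFDerivAt (by simp)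
  refine ⟨g, hg2, hg1, hg0, ?_⟩
  have e1 : ∀ᶠ h in 𝓝 h₀, enthalpy P (g h) = h := by
    rw [← hE]; exact hf.eventually_right_inverse
  have e2 : ∀ᶠ h in 𝓝 h₀, 0 < g h :=
    hg1.continuousAt.eventually (by rw [hg0]; exact Ioi_mem_nhds hs)
  filter_upwards [e1, e2, Ioi_mem_nhds hh] with h h1 h2 h3 s hs'
  obtain ⟨h4, h5⟩ := hs'.1 h3
  -- The inverse function theorem is only local; global strict monotonicity excludes any other
  -- density with the same enthalpy.
  exact hP.strictMonoOn_enthalpy.injOn h4 h2 (h5.trans h1.symm)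

theorem BarotropicLaw.contDiffAt_density (hP : BarotropicLaw P A γ Λ) {E : Type*}
    [NormedAddCommGroup E] [NormedSpace ℝ E] {n : ℕ∞} {w ρ : E → ℝ}
    (hρ : ∀ x, IsDensityAt P (w x) (ρ x)) {x : E} (hx : 0 < w x) (hw : ContDiffAt ℝ n w x) :
    ContDiffAt ℝ n ρ x := by
  obtain ⟨g, hg, -, -, hev⟩ := hP.exists_localInverse hx (hρ x)
  refine ((hg.of_le (by exact_mod_cast le_top)).comp x hw).congr_of_eventuallyEq ?_
  filter_upwards [hw.continuousAt.eventually hev] with y hy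
  exact hy _ (hρ y)

end Barotropic

/-! ### Radial functions of class C². -/

section Radial

variable {E : Type*} [NormedAddCommGroup E] [InnerProductSpace ℝ E]

theorem hasFDerivAt_norm_of_ne_zero {x : E} (hx : x ≠ 0) :
    HasFDerivAt (fun y : E => ‖y‖) (‖x‖⁻¹ • innerSL ℝ x) x := by
  have hx' : ‖x‖ ≠ 0 := norm_ne_zero_iff.2 hx
  have h := (hasStrictFDerivAt_norm_sq x).hasFDerivAt.sqrt (pow_ne_zero 2 hx')
  simp only [Real.sqrt_sq (norm_nonneg _)] at h
  convert! h using 1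
  ext v
  simp only [smul_apply, smul_eq_mul, nsmul_eq_mul]
  field_simp
  simp

/-- A radial function with a `C²` profile whose derivative vanishes at the origin is `C²`. -/
theorem contDiff_two_comp_norm {u : ℝ → ℝ} (hu : ContDiffOn ℝ 2 u (Ici 0))
    (h0 : derivWithin u (Ici 0) 0 = 0) : ContDiff ℝ 2 (fun x : E => u ‖x‖) := by
  set u₁ := derivWithin u (Ici 0) with hu₁
  set u₂ := derivWithin u₁ (Ici 0) with hu₂
  have hud : UniqueDiffOn ℝ (Ici (0 : ℝ)) := uniqueDiffOn_Ici 0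
  have hC1 : ContDiffOn ℝ 1 u₁ (Ici 0) :=
    ((contDiffOn_succ_iff_derivWithin (n := 1) hud).1 (by simpa [one_add_one_eq_two] using hu)).2.2
  have hC2 : ContinuousOn u₂ (Ici 0) := hC1.continuousOn_derivWithin hud le_rfl
  have hd1 : ∀ r ∈ Ici (0 : ℝ), HasDerivWithinAt u (u₁ r) (Ici 0) r := fun r hr =>
    ((hu.differentiableOn (by simp)) r hr).hasDerivWithinAt
  have hd2 : ∀ r ∈ Ici (0 : ℝ), HasDerivWithinAt u₁ (u₂ r) (Ici 0) r := fun r hr =>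
    ((hC1.differentiableOn (by simp)) r hr).hasDerivWithinAt
  have hnorm0 : Tendsto (fun y : E => ‖y‖) (𝓝 0) (𝓝[Ici 0] 0) :=
    tendsto_nhdsWithin_iff.2 ⟨by simpa using (continuous_norm.tendsto (0 : E)), by simp⟩
  -- The gradient of u(‖x‖) is a(‖x‖)x. Since u'(0) = 0, the quotient u'(r)/r is a difference
  -- quotient of u' and extends continuously by u''(0).
  let a : ℝ → ℝ := fun r => if r = 0 then u₂ 0 else u₁ r / r
  have ha0 : a 0 = u₂ 0 := if_pos rfl
  have ha : ∀ r, r ≠ 0 → a r = u₁ r / r := fun r hr => if_neg hr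
  have hac : ContinuousOn a (Ici 0) := by
    intro r hr
    rcases eq_or_lt_of_le (show (0 : ℝ) ≤ r from hr) with rfl | hr
    · have h := hasDerivWithinAt_iff_tendsto_slope.1 (hd2 0 self_mem_Ici)
      rw [← continuousWithinAt_sdiff_self, ContinuousWithinAt, ha0]
      refine h.congr' ?_
      filter_upwards [self_mem_nhdsWithin] with s hs
      rw [slope_def_field, h0, ha s hs.2]
      simp
    · have h : ContinuousWithinAt (fun r => u₁ r / r) (Ici 0) r :=
        (hC1.continuousOn r hr.le).div continuousWithinAt_id hr.ne'
      refine h.congr_of_eventuallyEq ?_ (ha r hr.ne')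
      filter_upwards [mem_nhdsWithin_of_mem_nhds (Ioi_mem_nhds hr)] with s hs
      exact ha s (ne_of_gt hs)
  have hcn : ∀ f : ℝ → ℝ, ContinuousOn f (Ici 0) → Continuous fun x : E => f ‖x‖ := fun f hf =>
    hf.comp_continuous continuous_norm fun x => norm_nonneg x
  have hw : ∀ x : E, HasFDerivAt (fun x : E => u ‖x‖) (innerSL ℝ (a ‖x‖ • x)) x := by
    intro x
    rcases eq_or_ne x 0 with rfl | hx
    · have h := (hasDerivWithinAt_iff_isLittleO.1 (hd1 0 self_mem_Ici)).comp_tendsto hnorm0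
      rw [hasFDerivAt_iff_isLittleO]
      rw [h0] at h
      refine Asymptotics.isLittleO_norm_right.1 ?_
      simpa [Function.comp_def] using h
    · have hn : 0 < ‖x‖ := norm_pos_iff.2 hx
      have h := ((hd1 _ hn.le).hasDerivAt (Ici_mem_nhds hn)).comp_hasFDerivAt x
        (hasFDerivAt_norm_of_ne_zero hx)
      convert! h using 1
      rw [ha _ hn.ne', map_smul, smul_smul]
      rfl
  let b : ℝ → ℝ := fun r => u₂ r - a r
  have hbc : ContinuousOn b (Ici 0) := hC2.sub hac
  -- The Hessian is a(‖x‖) id + M x, with M of rank at most one. At the origin M vanishes, as it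
  -- must, because the inverse of 0 is 0.
  let M : E → E →L[ℝ] E := fun x => (b ‖x‖ * (‖x‖⁻¹ * ‖x‖⁻¹)) • (innerSL ℝ x).smulRight x
  have hG : ∀ x : E, HasFDerivAt (fun x : E => a ‖x‖ • x)
      (a ‖x‖ • ContinuousLinearMap.id ℝ E + M x) x := by
    intro x
    rcases eq_or_ne x 0 with rfl | hx
    · rw [hasFDerivAt_iff_isLittleO]
      have h1 : Tendsto (fun y : E => a ‖y‖ - a 0) (𝓝 0) (𝓝 0) := by
        have := ((hcn a hac).tendsto 0).sub_const (a 0)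
        simpa using this
      have h2 := ((Asymptotics.isLittleO_one_iff ℝ).2 h1).smul_isBigO
        (Asymptotics.isBigO_refl (fun y : E => y) (𝓝 0))
      simpa [M, sub_smul] using h2
    · have hn : 0 < ‖x‖ := norm_pos_iff.2 hx
      have hN := hasFDerivAt_norm_of_ne_zero hx
      have h1 := ((hd2 _ hn.le).hasDerivAt (Ici_mem_nhds hn)).div (hasDerivAt_id ‖x‖) hn.ne'
      have h2 := (h1.comp_hasFDerivAt x hN).smul (hasFDerivAt_id x)
      have h3 : HasFDerivAt (fun x : E => a ‖x‖ • x) _ x := h2.congr_of_eventuallyEq (by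
        filter_upwards [isOpen_ne.mem_nhds hx] with y hy
        simp [ha _ (norm_ne_zero_iff.2 hy)])
      convert! h3 using 1
      ext v
      simp only [M, b, ha _ hn.ne', add_apply, smul_apply,
        ContinuousLinearMap.smulRight_apply, Function.comp_apply, Pi.div_apply, id_eq,
        ContinuousLinearMap.id_apply, smul_smul, smul_eq_mul]
      congr 2
      field_simp
  have hM : Continuous M := by
    rw [continuous_iff_continuousAt]
    intro x
    rcases eq_or_ne x 0 with rfl | hx
    · have hM0 : M 0 = 0 := by simp [M]
      rw [ContinuousAt, hM0]
      have hb0 : b 0 = 0 := by simp [b, ha0]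
      have h1 : Tendsto (fun y : E => ‖b ‖y‖‖) (𝓝 0) (𝓝 0) := by
        have := ((hcn b hbc).norm.tendsto 0)
        simpa [hb0] using this
      -- The direction of y has no limit at 0, but the norm of M y is at most |b(‖y‖)|, which tends
      -- to b(0) = 0.
      refine squeeze_zero_norm (fun y => ?_) h1
      rw [norm_smul, ContinuousLinearMap.norm_smulRight_apply, innerSL_apply_norm, norm_mul,
        norm_mul, norm_inv, norm_norm, mul_assoc]
      refine mul_le_of_le_one_right (norm_nonneg _) ?_
      rcases eq_or_ne y 0 with rfl | hy
      · simp
      · have : ‖y‖ ≠ 0 := norm_ne_zero_iff.2 hy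
        field_simp
        exact le_rfl
    · have hn : ‖x‖ ≠ 0 := norm_ne_zero_iff.2 hx
      have h1 : ContinuousAt (fun y : E => b ‖y‖ * (‖y‖⁻¹ * ‖y‖⁻¹)) x :=
        (hcn b hbc).continuousAt.mul
          ((continuous_norm.continuousAt.inv₀ hn).mul (continuous_norm.continuousAt.inv₀ hn))
      have h2 : Continuous fun y : E => (innerSL ℝ y).smulRight y := by fun_prop
      exact h1.smul h2.continuousAt
  have hG1 : ContDiff ℝ 1 (fun x : E => a ‖x‖ • x) := by
    refine contDiff_one_iff_hasFDerivAt.2 ⟨_, ?_, hG⟩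
    exact ((hcn a hac).smul continuous_const).add hM
  rw [← one_add_one_eq_two]
  refine (contDiff_succ_iff_hasFDerivAt (n := 1)).2 ⟨_, ?_, hw⟩
  exact (innerSL ℝ : E →L[ℝ] E →L[ℝ] ℝ).contDiff.comp hG1

end Radial

/-! ### Regularity and bounds of the equilibrium density. -/

section Equilibrium

variable {P : ℝ → ℝ} {A γ : ℝ} {Λ : ℝ → ℝ} {G : ℝ} {u : ℝ → ℝ} {ρ : Space → ℝ} {R α : ℝ}

theorem mem_openBall_iff {x : Space} : x ∈ openBall R ↔ ‖x‖ < R := mem_ball_zero_iff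

theorem SphericalEquilibrium.enthalpy_pos (hS : SphericalEquilibrium P G u ρ R α) {x : Space}
    (hx : x ∈ openBall R) : 0 < u ‖x‖ :=
  (hS.pos_iff _ (norm_nonneg x)).2 (mem_openBall_iff.1 hx)

theorem SphericalEquilibrium.zero_mem (hS : SphericalEquilibrium P G u ρ R α) :
    (0 : Space) ∈ openBall R :=
  mem_openBall_iff.2 (by simpa using hS.R_pos)

theorem SphericalEquilibrium.density_pos (hS : SphericalEquilibrium P G u ρ R α) {x : Space}
    (hx : x ∈ openBall R) : 0 < ρ x :=
  ((hS.density x).1 (hS.enthalpy_pos hx)).1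

theorem SphericalEquilibrium.density_eq_zero (hS : SphericalEquilibrium P G u ρ R α) {x : Space}
    (hx : x ∉ openBall R) : ρ x = 0 := by
  refine (hS.density x).2 (not_lt.1 fun h => hx ?_)
  exact mem_openBall_iff.2 ((hS.pos_iff _ (norm_nonneg x)).1 h)

theorem SphericalEquilibrium.density_nonneg (hS : SphericalEquilibrium P G u ρ R α) (x : Space) :
    0 ≤ ρ x := by
  by_cases hx : x ∈ openBall R
  · exact (hS.density_pos hx).le
  · exact (hS.density_eq_zero hx).ge

/-- Both u and the enthalpy are strictly monotone, so the density peaks at the centre. The value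
ρ(0) enters the lower bound of L. -/
theorem SphericalEquilibrium.density_le (hP : BarotropicLaw P A γ Λ)
    (hS : SphericalEquilibrium P G u ρ R α) (x : Space) : ρ x ≤ ρ 0 := by
  by_cases hx : x ∈ openBall R
  · have hanti : StrictAntiOn u (Ici 0) := by
      refine strictAntiOn_of_deriv_neg (convex_Ici 0) hS.contDiff_two.continuousOn fun r hr => ?_
      rw [interior_Ici] at hr
      exact hS.deriv_neg r hr
    obtain ⟨h1, h2⟩ := (hS.density x).1 (hS.enthalpy_pos hx)
    obtain ⟨h3, h4⟩ := (hS.density 0).1 (hS.enthalpy_pos hS.zero_mem)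
    refine (hP.strictMonoOn_enthalpy.le_iff_le h1 h3).1 ?_
    rw [h2, h4, norm_zero]
    exact hanti.antitoneOn self_mem_Ici (norm_nonneg x) (norm_nonneg x)
  · rw [hS.density_eq_zero hx]
    exact hS.density_nonneg 0

/-- Because dP = ρ du, the derivative of the pressure at the origin is ρ(0)u'(0) in every unit
direction. A linear map with the same value at v and -v vanishes at v. -/
theorem SphericalEquilibrium.derivWithin_zero (hP : BarotropicLaw P A γ Λ)
    (hS : SphericalEquilibrium P G u ρ R α) : derivWithin u (Ici 0) 0 = 0 := by
  have hu0 : 0 < u 0 := by simpa using hS.enthalpy_pos hS.zero_mem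
  have hd0 : IsDensityAt P (u 0) (ρ 0) := by simpa using hS.density 0
  have hρ0 : 0 < ρ 0 := hS.density_pos hS.zero_mem
  obtain ⟨g, -, hg, hg0, hev⟩ := hP.exists_localInverse hu0 hd0
  have hu : HasDerivWithinAt u (derivWithin u (Ici 0) 0) (Ici 0) 0 :=
    ((hS.contDiff_two.differentiableOn (by simp)) 0 self_mem_Ici).hasDerivWithinAt
  have hPρ := (hS.differentiableAt_pressure 0 hS.zero_mem).hasFDerivAt
  set f' := fderiv ℝ (fun y => P (ρ y)) 0
  have key : ∀ v : Space, ‖v‖ = 1 → f' v = ρ 0 * derivWithin u (Ici 0) 0 := by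
    intro v hv
    have h1 : HasDerivAt (fun r : ℝ => P (ρ (r • v))) (f' v) 0 := by
      have h2 : HasDerivAt (fun r : ℝ => r • v) v 0 := by
        simpa using (hasDerivAt_id (0 : ℝ)).smul_const v
      have h3 : HasFDerivAt (fun y => P (ρ y)) f' ((0 : ℝ) • v) := by simpa using hPρ
      exact h3.comp_hasDerivAt 0 h2
    have h4 : HasDerivWithinAt (fun r => P (g (u r)))
        (deriv P (ρ 0) * ((deriv P (ρ 0) / ρ 0)⁻¹ * derivWithin u (Ici 0) 0)) (Ici 0) 0 := by
      have h5 : HasDerivAt P (deriv P (ρ 0)) (g (u 0)) := by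
        rw [hg0]; exact hP.hasDerivAt hρ0
      exact h5.comp_hasDerivWithinAt 0 (hg.comp_hasDerivWithinAt 0 hu)
    have h6 : HasDerivWithinAt (fun r : ℝ => P (ρ (r • v)))
        (deriv P (ρ 0) * ((deriv P (ρ 0) / ρ 0)⁻¹ * derivWithin u (Ici 0) 0)) (Ici 0) 0 := by
      refine h4.congr_of_eventuallyEq ?_ (by simp [hg0])
      filter_upwards [hu.continuousWithinAt.eventually hev, self_mem_nhdsWithin] with r hr hr0
      have hd := hS.density (r • v)
      rw [norm_smul, hv, mul_one, Real.norm_of_nonneg hr0] at hd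
      rw [hr _ hd]
    have h7 := (uniqueDiffWithinAt_Ici (0 : ℝ)).eq_deriv _ h1.hasDerivWithinAt h6
    have h8 : deriv P (ρ 0) ≠ 0 := (hP.deriv_pos _ hρ0).ne'
    rw [h7]
    field_simp
  have h1 := key (EuclideanSpace.single 0 1) (by simp)
  have h2 := key (-EuclideanSpace.single 0 1) (by simp)
  rw [map_neg, h1] at h2
  have h3 : ρ 0 * derivWithin u (Ici 0) 0 = 0 := by linarith
  exact (mul_eq_zero.1 h3).resolve_left hρ0.ne'

theorem SphericalEquilibrium.contDiffAt_density (hP : BarotropicLaw P A γ Λ)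
    (hS : SphericalEquilibrium P G u ρ R α) {x : Space} (hx : x ∈ openBall R) :
    ContDiffAt ℝ 2 ρ x :=
  hP.contDiffAt_density (n := 2) (w := fun x => u ‖x‖) hS.density (hS.enthalpy_pos hx)
    (contDiff_two_comp_norm hS.contDiff_two (hS.derivWithin_zero hP)).contDiffAt

theorem SphericalEquilibrium.measurable_density (hP : BarotropicLaw P A γ Λ)
    (hS : SphericalEquilibrium P G u ρ R α) : Measurable ρ := by
  classical
  have hc : ContinuousOn ρ (openBall R) := fun x hx =>
    (hS.contDiffAt_density hP hx).continuousAt.continuousWithinAt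
  have h : ρ = (openBall R : Set Space).piecewise ρ 0 := by
    ext x
    by_cases hx : x ∈ (openBall R : Set Space)
    · simp [hx]
    · simp only [hx, not_false_eq_true, piecewise_eq_of_notMem, Pi.zero_apply]
      exact hS.density_eq_zero hx
  rw [h]
  exact hc.measurable_piecewise continuousOn_const (openBall R).isOpen.measurableSet

end Equilibrium

/-! ### Gaussian means and one half of Plancherel's theorem. -/

section Gauss

open scoped FourierTransform ComplexConjugate

variable {V : Type*} [NormedAddCommGroup V] [InnerProductSpace ℝ V]

/-- The Fourier transform of `exp (-a ‖·‖²)`. -/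
noncomputable def gaussKernel (V : Type*) [NormedAddCommGroup V] [InnerProductSpace ℝ V] (a : ℝ) (w : V) : ℝ :=
  (Real.pi / a) ^ ((Module.finrank ℝ V : ℝ) / 2) * Real.exp (-Real.pi ^ 2 * ‖w‖ ^ 2 / a)

theorem gaussKernel_nonneg {a : ℝ} (ha : 0 < a) (w : V) : 0 ≤ gaussKernel V a w := by
  unfold gaussKernel; positivity

theorem continuous_gaussKernel (a : ℝ) : Continuous (gaussKernel V a) := by
  unfold gaussKernel; fun_prop

variable [FiniteDimensional ℝ V] [MeasurableSpace V] [BorelSpace V]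

theorem integral_exp_neg_mul_sq_mul_fourierChar {a : ℝ} (ha : 0 < a) (w : V) :
    ∫ k : V, Complex.exp (-a * ‖k‖ ^ 2 + 2 * Real.pi * Complex.I * ⟪w, k⟫_ℝ) =
      gaussKernel V a w := by
  rw [GaussianFourier.integral_cexp_neg_mul_sq_norm_add (by simpa using ha), gaussKernel,
    Complex.ofReal_mul, Complex.ofReal_cpow (by positivity), Complex.ofReal_exp]
  congr 1
  · push_cast; rfl
  · congr 1
    push_cast
    have : (a : ℂ) ≠ 0 := by exact_mod_cast ha.ne'
    field_simp
    ring_nf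
    simp

theorem integral_gaussKernel {a : ℝ} (ha : 0 < a) : ∫ w : V, gaussKernel V a w = 1 := by
  unfold gaussKernel
  have h := GaussianFourier.integral_rexp_neg_mul_sq_norm (V := V) (b := Real.pi ^ 2 / a)
    (by positivity)
  rw [integral_const_mul]
  have e : (fun w : V => Real.exp (-Real.pi ^ 2 * ‖w‖ ^ 2 / a)) =
      fun w : V => Real.exp (-(Real.pi ^ 2 / a) * ‖w‖ ^ 2) := by
    ext w; congr 1; ring
  rw [e, h, ← Real.mul_rpow (by positivity) (by positivity)]
  have : Real.pi / a * (Real.pi / (Real.pi ^ 2 / a)) = 1 := by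
    have := Real.pi_pos.ne'
    field_simp
  rw [this, Real.one_rpow]

/-- A function that is not integrable has Bochner integral 0 by convention, whereas this integral is
1. -/
theorem integrable_gaussKernel {a : ℝ} (ha : 0 < a) : Integrable (gaussKernel V a) := by
  by_contra h
  have h1 := integral_gaussKernel (V := V) ha
  rw [integral_undef h] at h1
  exact zero_ne_one h1

theorem continuous_fourier {f : V → ℂ} (hf : Integrable f) : Continuous (𝓕 f) :=
  VectorFourier.fourierIntegral_continuous Real.continuous_fourierChar
    (by simpa using (continuous_inner (𝕜 := ℝ) (E := V))) hf

/-- As an integral over pairs, |𝓕 f|² carries a single phase in k, which a Gaussian weight in k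
turns into `gaussKernel`. -/
theorem conj_fourier_mul_fourier {f : V → ℂ} (k : V) :
    conj (𝓕 f k) * 𝓕 f k = ∫ p : V × V, conj (f p.1) * f p.2 *
      Complex.exp (2 * Real.pi * Complex.I * ⟪p.1 - p.2, k⟫_ℝ) := by
  have h1 : conj (𝓕 f k) = ∫ x, conj (f x) * Complex.exp (2 * Real.pi * Complex.I * ⟪x, k⟫_ℝ) := by
    rw [Real.fourier_eq', ← integral_conj]
    congr 1 with x
    rw [smul_eq_mul, map_mul, ← Complex.exp_conj, mul_comm]
    congr 2
    simp only [map_mul, Complex.conj_ofReal, Complex.conj_I]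
    push_cast
    ring
  have h2 : 𝓕 f k = ∫ x, f x * Complex.exp (-(2 * Real.pi * Complex.I * ⟪x, k⟫_ℝ)) := by
    rw [Real.fourier_eq']
    congr 1 with x
    rw [smul_eq_mul, mul_comm]
    congr 2
    push_cast
    ring
  rw [h1, h2, ← integral_prod_mul]
  congr 1 with p
  rw [mul_mul_mul_comm, ← Complex.exp_add, inner_sub_left]
  congr 2
  push_cast
  ring

theorem integrable_conj_mul {f g : V → ℂ} (hf : Integrable f) (hg : Integrable g) :
    Integrable (fun p : V × V => conj (f p.1) * g p.2) (volume.prod volume) := by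
  have h : Integrable (fun x => conj (f x)) := by
    refine (integrable_norm_iff ?_).1 (by simpa using hf.norm)
    exact Complex.continuous_conj.comp_aestronglyMeasurable hf.1
  exact h.mul_prod hg

/-- The Gaussian means of `|𝓕 f|²`, in physical space. -/
theorem integral_exp_mul_normSq_fourier {f : V → ℂ} (hf : Integrable f) {a : ℝ} (ha : 0 < a) :
    ((∫ k : V, Real.exp (-a * ‖k‖ ^ 2) * ‖𝓕 f k‖ ^ 2 : ℝ) : ℂ) =
      ∫ p : V × V, conj (f p.1) * f p.2 * gaussKernel V a (p.1 - p.2) := by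
  have hF := integrable_conj_mul hf hf
  have hint : Integrable (fun q : V × (V × V) => Complex.exp (-a * ‖q.1‖ ^ 2) *
      (conj (f q.2.1) * f q.2.2 *
        Complex.exp (2 * Real.pi * Complex.I * ⟪q.2.1 - q.2.2, q.1⟫_ℝ)))
      (volume.prod (volume.prod volume)) := by
    have h1 : Integrable (fun k : V => Complex.exp (-a * ‖k‖ ^ 2)) := by
      simpa using GaussianFourier.integrable_cexp_neg_mul_sq_norm_add (V := V) (b := a)
        (by simpa using ha) 0 0
    refine (h1.mul_prod hF).mono ?_ (Eventually.of_forall fun q => ?_)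
    · refine h1.1.comp_fst.mul ((hF.1.comp_snd).mul ?_)
      exact Continuous.aestronglyMeasurable (by fun_prop)
    · simp only [norm_mul]
      refine le_of_eq ?_
      have : ‖Complex.exp (2 * Real.pi * Complex.I * ⟪q.2.1 - q.2.2, q.1⟫_ℝ)‖ = 1 := by
        rw [Complex.norm_exp]
        simp
      rw [this, mul_one]
  have h2 : ((∫ k : V, Real.exp (-a * ‖k‖ ^ 2) * ‖𝓕 f k‖ ^ 2 : ℝ) : ℂ) =
      ∫ k : V, ∫ p : V × V, Complex.exp (-a * ‖k‖ ^ 2) * (conj (f p.1) * f p.2 *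
        Complex.exp (2 * Real.pi * Complex.I * ⟪p.1 - p.2, k⟫_ℝ)) := by
    rw [← integral_complex_ofReal]
    congr 1 with k
    rw [integral_const_mul, ← conj_fourier_mul_fourier, Complex.conj_mul']
    push_cast
    rfl
  rw [h2, integral_integral_swap hint]
  congr 1 with p
  rw [← integral_exp_neg_mul_sq_mul_fourierChar ha, ← integral_const_mul]
  congr 1 with k
  rw [Complex.exp_add]
  ring

/-- A Schur test: 2|f(x)f(y)| ≤ |f(x)|² + |f(y)|², and the Gaussian kernel has mass one in each
variable. -/
theorem integral_exp_mul_normSq_fourier_le {f : V → ℂ} (hf : Integrable f)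
    {a : ℝ} (ha : 0 < a) :
    ENNReal.ofReal (∫ k : V, Real.exp (-a * ‖k‖ ^ 2) * ‖𝓕 f k‖ ^ 2) ≤ ∫⁻ x, ‖f x‖ₑ ^ 2 := by
  have hnn : 0 ≤ ∫ k : V, Real.exp (-a * ‖k‖ ^ 2) * ‖𝓕 f k‖ ^ 2 :=
    integral_nonneg fun k => by positivity
  have hker : ∫⁻ w : V, ENNReal.ofReal (gaussKernel V a w) = 1 := by
    rw [← ofReal_integral_eq_lintegral_ofReal (integrable_gaussKernel ha)
      (Eventually.of_forall (gaussKernel_nonneg ha)), integral_gaussKernel ha, ENNReal.ofReal_one]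
  have hmk : Measurable fun w : V => ENNReal.ofReal (gaussKernel V a w) :=
    (continuous_gaussKernel a).measurable.ennreal_ofReal
  have hsub : Measurable fun p : V × V => ENNReal.ofReal (gaussKernel V a (p.1 - p.2)) :=
    hmk.comp (measurable_fst.sub measurable_snd)
  have hf1 : AEMeasurable (fun p : V × V => ‖f p.1‖ₑ ^ 2) (volume.prod volume) :=
    (hf.1.comp_fst.enorm.pow_const 2)
  have hf2 : AEMeasurable (fun p : V × V => ‖f p.2‖ₑ ^ 2) (volume.prod volume) :=
    (hf.1.comp_snd.enorm.pow_const 2)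
  have hg1 : AEMeasurable (fun p : V × V => ‖f p.1‖ₑ ^ 2 *
      ENNReal.ofReal (gaussKernel V a (p.1 - p.2))) (volume.prod volume) := hf1.mul hsub.aemeasurable
  have hg2 : AEMeasurable (fun p : V × V => ‖f p.2‖ₑ ^ 2 *
      ENNReal.ofReal (gaussKernel V a (p.1 - p.2))) (volume.prod volume) := hf2.mul hsub.aemeasurable
  have i1 : ∫⁻ p : V × V, ‖f p.1‖ₑ ^ 2 * ENNReal.ofReal (gaussKernel V a (p.1 - p.2))
      ∂(volume.prod volume) = ∫⁻ x, ‖f x‖ₑ ^ 2 := by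
    rw [lintegral_prod _ hg1]
    congr 1 with x
    dsimp only
    rw [lintegral_const_mul' _ _ (by simp),
      lintegral_sub_left_eq_self (fun w => ENNReal.ofReal (gaussKernel V a w)) x, hker, mul_one]
  have i2 : ∫⁻ p : V × V, ‖f p.2‖ₑ ^ 2 * ENNReal.ofReal (gaussKernel V a (p.1 - p.2))
      ∂(volume.prod volume) = ∫⁻ x, ‖f x‖ₑ ^ 2 := by
    rw [lintegral_prod_symm _ hg2]
    congr 1 with y
    dsimp only
    rw [lintegral_const_mul' _ _ (by simp),
      lintegral_sub_right_eq_self (fun w => ENNReal.ofReal (gaussKernel V a w)) y, hker, mul_one]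
  have hyoung : ∀ s t : ℝ≥0∞, 2 * (s * t) ≤ s ^ 2 + t ^ 2 := fun s t => by
    rcases le_total s t with h | h
    · obtain ⟨d, rfl⟩ := exists_add_of_le h
      calc 2 * (s * (s + d)) ≤ 2 * (s * (s + d)) + d ^ 2 := le_self_add
        _ = s ^ 2 + (s + d) ^ 2 := by ring
    · obtain ⟨d, rfl⟩ := exists_add_of_le h
      calc 2 * ((t + d) * t) ≤ 2 * ((t + d) * t) + d ^ 2 := le_self_add
        _ = (t + d) ^ 2 + t ^ 2 := by ring
  have hmain : 2 * ENNReal.ofReal (∫ k : V, Real.exp (-a * ‖k‖ ^ 2) * ‖𝓕 f k‖ ^ 2) ≤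
      2 * ∫⁻ x, ‖f x‖ₑ ^ 2 := by
    have e : ENNReal.ofReal (∫ k : V, Real.exp (-a * ‖k‖ ^ 2) * ‖𝓕 f k‖ ^ 2) =
        ‖∫ p : V × V, conj (f p.1) * f p.2 * gaussKernel V a (p.1 - p.2)‖ₑ := by
      rw [← integral_exp_mul_normSq_fourier hf ha, ← ofReal_norm, Complex.norm_real,
        Real.norm_of_nonneg hnn]
    rw [e]
    calc 2 * ‖∫ p : V × V, conj (f p.1) * f p.2 * gaussKernel V a (p.1 - p.2)‖ₑ
        ≤ 2 * ∫⁻ p : V × V, ‖conj (f p.1) * f p.2 * gaussKernel V a (p.1 - p.2)‖ₑ :=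
          mul_le_mul_right (enorm_integral_le_lintegral_enorm _) 2
      _ = ∫⁻ p : V × V, 2 * (‖f p.1‖ₑ * ‖f p.2‖ₑ) *
            ENNReal.ofReal (gaussKernel V a (p.1 - p.2)) := by
          rw [← lintegral_const_mul' _ _ (by simp)]
          congr 1 with p
          rw [enorm_mul, enorm_mul, RCLike.enorm_conj,
            ← ofReal_norm (gaussKernel V a (p.1 - p.2) : ℂ), Complex.norm_real,
            Real.norm_of_nonneg (gaussKernel_nonneg ha _)]
          ring
      _ ≤ ∫⁻ p : V × V, (‖f p.1‖ₑ ^ 2 + ‖f p.2‖ₑ ^ 2) *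
            ENNReal.ofReal (gaussKernel V a (p.1 - p.2)) :=
          lintegral_mono fun p => mul_le_mul_left (hyoung _ _) _
      _ = 2 * ∫⁻ x, ‖f x‖ₑ ^ 2 := by
          simp_rw [add_mul]
          rw [Measure.volume_eq_prod, lintegral_add_left' hg1, i1, i2,
            two_mul]
  exact (ENNReal.mul_le_mul_iff_right (by simp) (by simp)).1 hmain

theorem integrable_exp_mul_normSq_fourier {f : V → ℂ} (hf : Integrable f) {a : ℝ} (ha : 0 < a) :
    Integrable fun k : V => Real.exp (-a * ‖k‖ ^ 2) * ‖𝓕 f k‖ ^ 2 := by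
  have h1 : Integrable (fun k : V => Real.exp (-a * ‖k‖ ^ 2)) := by
    have := (GaussianFourier.integrable_cexp_neg_mul_sq_norm_add (V := V) (b := a)
        (by simpa using ha) 0 0).norm
    refine this.congr (Eventually.of_forall fun k => ?_)
    simp only [Complex.norm_exp]
    congr 1
    rw [zero_mul, add_zero]
    norm_cast
  refine h1.mul_bdd (c := (∫ x, ‖f x‖) ^ 2)
    ((continuous_fourier hf).norm.pow 2).aestronglyMeasurable (Eventually.of_forall fun k => ?_)
  rw [norm_pow, norm_norm]
  gcongr
  exact VectorFourier.norm_fourierIntegral_le_integral_norm _ _ _ _ _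

theorem ofReal_integral_exp_mul_normSq_fourier {f : V → ℂ} (hf : Integrable f) {a : ℝ}
    (ha : 0 < a) :
    ENNReal.ofReal (∫ k : V, Real.exp (-a * ‖k‖ ^ 2) * ‖𝓕 f k‖ ^ 2) =
      ∫⁻ k, ENNReal.ofReal (Real.exp (-a * ‖k‖ ^ 2)) * ‖𝓕 f k‖ₑ ^ 2 := by
  rw [ofReal_integral_eq_lintegral_ofReal (integrable_exp_mul_normSq_fourier hf ha)
    (Eventually.of_forall fun k => by positivity)]
  congr 1 with k
  rw [ENNReal.ofReal_mul (by positivity), ENNReal.ofReal_pow (norm_nonneg _),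
    ofReal_norm]

/-- One half of Plancherel's theorem, for integrable functions. -/
theorem lintegral_enorm_fourier_sq_le {f : V → ℂ} (hf : Integrable f) :
    ∫⁻ k, ‖𝓕 f k‖ₑ ^ 2 ≤ ∫⁻ x, ‖f x‖ₑ ^ 2 := by
  have hm : Measurable fun k => ‖𝓕 f k‖ₑ ^ 2 := (continuous_fourier hf).measurable.enorm.pow_const 2
  -- The Gaussian weights with a = 1/(n + 1) tend to 1, and Fatou's lemma carries the uniform bound
  -- to the limit.
  let F : ℕ → V → ℝ≥0∞ := fun n k =>
    ENNReal.ofReal (Real.exp (-(1 / ((n : ℝ) + 1)) * ‖k‖ ^ 2)) * ‖𝓕 f k‖ₑ ^ 2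
  have hlim : ∀ k, Tendsto (fun n => F n k) atTop (𝓝 (‖𝓕 f k‖ₑ ^ 2)) := by
    intro k
    have h1 : Tendsto (fun n : ℕ => Real.exp (-(1 / ((n : ℝ) + 1)) * ‖k‖ ^ 2)) atTop (𝓝 1) := by
      have := (tendsto_one_div_add_atTop_nhds_zero_nat (𝕜 := ℝ)).neg.mul_const (‖k‖ ^ 2)
      simpa using this.rexp
    have h2 := (ENNReal.tendsto_ofReal h1)
    rw [ENNReal.ofReal_one] at h2
    have h3 := ENNReal.Tendsto.mul_const (b := ‖𝓕 f k‖ₑ ^ 2) h2 (Or.inl one_ne_zero)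
    rwa [one_mul] at h3
  calc ∫⁻ k, ‖𝓕 f k‖ₑ ^ 2 = ∫⁻ k, liminf (fun n => F n k) atTop :=
        lintegral_congr fun k => (hlim k).liminf_eq.symm
    _ ≤ liminf (fun n => ∫⁻ k, F n k) atTop := by
        refine lintegral_liminf_le fun n => Measurable.mul ?_ hm
        exact (by fun_prop : Measurable fun k : V =>
          Real.exp (-(1 / ((n : ℝ) + 1)) * ‖k‖ ^ 2)).ennreal_ofReal
    _ ≤ ∫⁻ x, ‖f x‖ₑ ^ 2 := by
        refine liminf_le_of_frequently_le' (Eventually.of_forall fun n => ?_).frequently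
        rw [← ofReal_integral_exp_mul_normSq_fourier hf (by positivity)]
        exact integral_exp_mul_normSq_fourier_le hf (by positivity)

end Gauss

/-! ### The Newtonian potential and its energy. -/

section Newton

open scoped FourierTransform ComplexConjugate Convolution

theorem finrank_space : Module.finrank ℝ Space = 3 := finrank_euclideanSpace_fin

theorem locallyIntegrable_inv_norm : LocallyIntegrable fun x : Space => ‖x‖⁻¹ := by
  refine locallyIntegrable_of_norm_le_rpow (C := 1) (α := 1) (by rw [finrank_space]; norm_num)
    (by rw [finrank_space]; norm_num) (Eventually.of_forall fun x => ?_) ?_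
  · rw [Real.rpow_neg_one, one_mul, norm_inv, norm_norm]
  · exact measurable_norm.inv.aestronglyMeasurable

theorem newton_eq_convolution {F : Type*} [NormedAddCommGroup F] [NormedSpace ℝ F]
    (f : Space → F) (x : Space) :
    newton f x = (4 * Real.pi)⁻¹ •
      ((fun y : Space => ‖y‖⁻¹) ⋆[ContinuousLinearMap.lsmul ℝ ℝ, volume] f) x := by
  rw [newton, convolution_lsmul_swap]

/-- All derivatives fall on the compactly supported factor of the convolution, so local
integrability of the kernel is enough. -/
theorem contDiff_newton {F : Type*} [NormedAddCommGroup F] [NormedSpace ℝ F] {n : ℕ∞}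
    {f : Space → F} (hf : ContDiff ℝ n f) (hc : HasCompactSupport f) : ContDiff ℝ n (newton f) := by
  have h : newton f = fun x => (4 * Real.pi)⁻¹ •
      ((fun y : Space => ‖y‖⁻¹) ⋆[ContinuousLinearMap.lsmul ℝ ℝ, volume] f) x :=
    funext (newton_eq_convolution f)
  rw [h]
  exact (hc.contDiff_convolution_right _ locallyIntegrable_inv_norm hf).const_smul _

theorem integrable_newton_kernel {F : Type*} [NormedAddCommGroup F] [NormedSpace ℝ F]
    {f : Space → F} (hf : Continuous f) (hc : HasCompactSupport f) (x : Space) :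
    Integrable fun y => ‖x - y‖⁻¹ • f y := by
  have h := hc.convolutionExists_right (ContinuousLinearMap.lsmul ℝ ℝ)
    locallyIntegrable_inv_norm hf x
  have h2 := h.integrable_swap
  simpa using h2

/-- Integrating out one variable leaves |f| times the potential of |g|, a continuous function of
compact support. -/
theorem integrable_newton_pairing {f g : Space → ℂ} (hf : Continuous f)
    (hfc : HasCompactSupport f) (hg : Continuous g) (hgc : HasCompactSupport g) :
    Integrable (fun p : Space × Space => conj (f p.1) * g p.2 * (‖p.1 - p.2‖⁻¹ : ℝ))
      (volume.prod volume) := by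
  have hmeas : AEStronglyMeasurable
      (fun p : Space × Space => conj (f p.1) * g p.2 * (‖p.1 - p.2‖⁻¹ : ℝ))
      (volume.prod volume) := by
    refine AEStronglyMeasurable.mul (Continuous.aestronglyMeasurable (by fun_prop)) ?_
    exact (Complex.measurable_ofReal.comp
      (measurable_fst.sub measurable_snd).norm.inv).aestronglyMeasurable
  rw [integrable_prod_iff hmeas]
  have hrw : ∀ x y, ‖conj (f x) * g y * (‖x - y‖⁻¹ : ℝ)‖ = ‖f x‖ * (‖x - y‖⁻¹ • ‖g y‖) := by
    intro x y
    rw [norm_mul, norm_mul, Complex.norm_real, RCLike.norm_conj, norm_inv, norm_norm, smul_eq_mul]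
    ring
  refine ⟨Eventually.of_forall fun x => ?_, ?_⟩
  · refine ((integrable_newton_kernel hg hgc x).const_mul (conj (f x))).congr
      (Eventually.of_forall fun y => ?_)
    simp only [Complex.real_smul]
    ring
  · have hN : Continuous (newton fun y => ‖g y‖) :=
      (contDiff_newton (n := 0) (contDiff_zero.2 hg.norm) hgc.norm).continuous
    have h1 : Integrable fun x => ‖f x‖ * (newton (fun y => ‖g y‖) x * (4 * Real.pi)) :=
      Continuous.integrable_of_hasCompactSupport (by fun_prop) hfc.norm.mul_right
    refine h1.congr (Eventually.of_forall fun x => ?_)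
    simp only [hrw]
    rw [integral_const_mul, newton, smul_eq_mul]
    have := Real.pi_pos.ne'
    field_simp

theorem integral_conj_mul_newton {f g : Space → ℂ} (hf : Continuous f)
    (hfc : HasCompactSupport f) (hg : Continuous g) (hgc : HasCompactSupport g) :
    ∫ x, conj (f x) * newton g x = ((4 * Real.pi)⁻¹ : ℝ) *
      ∫ p : Space × Space, conj (f p.1) * g p.2 * (‖p.1 - p.2‖⁻¹ : ℝ) := by
  rw [Measure.volume_eq_prod, integral_prod _ (integrable_newton_pairing hf hfc hg hgc),
    ← integral_const_mul]
  congr 1 with x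
  rw [newton, Complex.real_smul, mul_left_comm]
  congr 1
  rw [← integral_const_mul]
  congr 1 with y
  rw [Complex.real_smul]
  ring

/-- The Newtonian potential is a symmetric operator. -/
theorem integral_conj_newton_mul {f g : Space → ℂ} (hf : Continuous f)
    (hfc : HasCompactSupport f) (hg : Continuous g) (hgc : HasCompactSupport g) :
    ∫ x, conj (newton f x) * g x = ∫ x, conj (f x) * newton g x := by
  have h1 : ∫ x, conj (newton f x) * g x = conj (∫ x, conj (g x) * newton f x) := by
    rw [← integral_conj]
    congr 1 with x
    rw [map_mul, Complex.conj_conj, mul_comm]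
  rw [h1, integral_conj_mul_newton hg hgc hf hfc, integral_conj_mul_newton hf hfc hg hgc, map_mul,
    Complex.conj_ofReal, ← integral_conj, Measure.volume_eq_prod, ← integral_prod_swap]
  congr 2 with p
  simp only [Prod.fst_swap, Prod.snd_swap, map_mul, Complex.conj_conj, Complex.conj_ofReal]
  rw [norm_sub_rev]
  ring

/-- The right side is the integrand after the substitution b = a⁻¹, with its Jacobian; in b the
integral is a Gamma integral at 1/2. -/
theorem gaussKernel_eq_of_pos {a : ℝ} (ha : 0 < a) (w : Space) :
    gaussKernel Space a w = (|(-1 : ℝ)| * a ^ ((-1 : ℝ) - 1)) • (Real.pi ^ (3 / 2 : ℝ) *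
      ((a ^ (-1 : ℝ)) ^ (1 / 2 - 1 : ℝ) *
        Real.exp (-(Real.pi ^ 2 * ‖w‖ ^ 2 * a ^ (-1 : ℝ))))) := by
  rw [gaussKernel, finrank_space, ← Real.rpow_mul ha.le, Real.div_rpow Real.pi_pos.le ha.le,
    smul_eq_mul, abs_neg, abs_one, one_mul]
  have e1 : Real.exp (-Real.pi ^ 2 * ‖w‖ ^ 2 / a) =
      Real.exp (-(Real.pi ^ 2 * ‖w‖ ^ 2 * a ^ (-1 : ℝ))) := by
    rw [Real.rpow_neg_one]; congr 1; ring
  rw [e1]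
  have e2 : a ^ ((-1 : ℝ) - 1) * a ^ ((-1 : ℝ) * (1 / 2 - 1)) = (a ^ (3 / 2 : ℝ))⁻¹ := by
    rw [← Real.rpow_add ha, ← Real.rpow_neg ha.le]; norm_num
  push_cast
  rw [div_eq_mul_inv, ← e2]
  ring

/-- The Newtonian kernel is a superposition of Gaussians. The power of a is the right one because
the dimension is 3. -/
theorem integral_gaussKernel_Ioi {w : Space} (hw : w ≠ 0) :
    IntegrableOn (fun a => gaussKernel Space a w) (Ioi 0) ∧
      ∫ a in Ioi (0 : ℝ), gaussKernel Space a w = Real.pi * ‖w‖⁻¹ := by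
  have hn : 0 < ‖w‖ := norm_pos_iff.2 hw
  have hpi := Real.pi_pos
  let g : ℝ → ℝ := fun b => Real.pi ^ (3 / 2 : ℝ) *
    (b ^ (1 / 2 - 1 : ℝ) * Real.exp (-(Real.pi ^ 2 * ‖w‖ ^ 2 * b)))
  have hg : ∫ b in Ioi (0 : ℝ), g b = Real.pi * ‖w‖⁻¹ := by
    rw [integral_const_mul, Real.integral_rpow_mul_exp_neg_mul_Ioi (by norm_num) (by positivity),
      Real.Gamma_one_half_eq, ← Real.sqrt_eq_rpow]
    have e1 : (1 : ℝ) / (Real.pi ^ 2 * ‖w‖ ^ 2) = (Real.pi⁻¹ * ‖w‖⁻¹) ^ 2 := by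
      field_simp
    have e2 : Real.pi ^ (3 / 2 : ℝ) = Real.pi * √Real.pi := by
      rw [Real.sqrt_eq_rpow, ← Real.rpow_one_add' hpi.le (by norm_num)]; norm_num
    rw [e1, Real.sqrt_sq (by positivity), e2]
    have : √Real.pi * √Real.pi = Real.pi := Real.mul_self_sqrt hpi.le
    calc Real.pi * √Real.pi * (Real.pi⁻¹ * ‖w‖⁻¹ * √Real.pi)
        = (√Real.pi * √Real.pi) * (Real.pi * Real.pi⁻¹) * ‖w‖⁻¹ := by ring
      _ = Real.pi * ‖w‖⁻¹ := by rw [this, mul_inv_cancel₀ hpi.ne', mul_one]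
  have hgi : IntegrableOn g (Ioi 0) := by
    by_contra h
    rw [integral_undef h] at hg
    have : 0 < Real.pi * ‖w‖⁻¹ := by positivity
    exact this.ne hg
  constructor
  · refine ((integrableOn_Ioi_comp_rpow_iff g (p := -1) (by norm_num)).2 hgi).congr_fun
      (fun a ha => ?_) measurableSet_Ioi
    exact (gaussKernel_eq_of_pos ha w).symm
  · rw [← hg, ← integral_comp_rpow_Ioi g (p := -1) (by norm_num)]
    exact setIntegral_congr_fun measurableSet_Ioi fun a ha => gaussKernel_eq_of_pos ha w

theorem ae_fst_ne_snd : ∀ᵐ p : Space × Space ∂(volume.prod volume), p.1 - p.2 ≠ 0 := by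
  have hs : MeasurableSet {p : Space × Space | p.1 - p.2 = 0} :=
    measurableSet_eq_fun (measurable_fst.sub measurable_snd) measurable_const
  have h : (volume.prod volume) {p : Space × Space | p.1 - p.2 = 0} = 0 := by
    rw [Measure.measure_prod_null hs]
    refine Eventually.of_forall fun x => ?_
    have : Prod.mk x ⁻¹' {p : Space × Space | p.1 - p.2 = 0} = {x} := by
      ext y; simp [sub_eq_zero, eq_comm]
    simp [this]
  rw [ae_iff]
  simpa using h

/-- The Newtonian energy as a superposition of Gaussian energies. -/
theorem pi_mul_integral_newton_pairing {f : Space → ℂ} (hf : Continuous f)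
    (hfc : HasCompactSupport f) :
    Real.pi * ∫ p : Space × Space, conj (f p.1) * f p.2 * (‖p.1 - p.2‖⁻¹ : ℝ) =
      ((∫ a in Ioi (0 : ℝ), ∫ k : Space, Real.exp (-a * ‖k‖ ^ 2) * ‖𝓕 f k‖ ^ 2 : ℝ) : ℂ) := by
  have hfi : Integrable f := hf.integrable_of_hasCompactSupport hfc
  let Φ : (Space × Space) → ℝ → ℂ := fun p a =>
    conj (f p.1) * f p.2 * gaussKernel Space a (p.1 - p.2)
  have hm : Measurable fun q : (Space × Space) × ℝ => gaussKernel Space q.2 (q.1.1 - q.1.2) := by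
    unfold gaussKernel
    fun_prop
  have hΦm : AEStronglyMeasurable (Function.uncurry Φ)
      ((volume.prod volume).prod (volume.restrict (Ioi 0))) := by
    refine AEStronglyMeasurable.mul (Continuous.aestronglyMeasurable (by fun_prop)) ?_
    exact (Complex.measurable_ofReal.comp hm).aestronglyMeasurable
  have hΦ : Integrable (Function.uncurry Φ)
      ((volume.prod volume).prod (volume.restrict (Ioi 0))) := by
    rw [integrable_prod_iff hΦm]
    constructor
    · filter_upwards [ae_fst_ne_snd] with p hp
      exact ((integral_gaussKernel_Ioi hp).1.ofReal (𝕜 := ℂ)).const_mul (conj (f p.1) * f p.2)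
    · refine ((integrable_newton_pairing hf hfc hf hfc).norm.const_mul Real.pi).congr ?_
      filter_upwards [ae_fst_ne_snd] with p hp
      have e : ∀ a ∈ Ioi (0 : ℝ), ‖Function.uncurry Φ (p, a)‖ =
          ‖conj (f p.1) * f p.2‖ * gaussKernel Space a (p.1 - p.2) := by
        intro a ha
        simp only [Function.uncurry, Φ]
        rw [norm_mul, Complex.norm_real, Real.norm_of_nonneg (gaussKernel_nonneg ha _)]
      rw [setIntegral_congr_fun measurableSet_Ioi e, integral_const_mul,
        (integral_gaussKernel_Ioi hp).2, norm_mul _ ((‖p.1 - p.2‖⁻¹ : ℝ) : ℂ), Complex.norm_real,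
        norm_inv, norm_norm]
      ring
  have h1 : Real.pi * ∫ p : Space × Space, conj (f p.1) * f p.2 * (‖p.1 - p.2‖⁻¹ : ℝ) =
      ∫ p : Space × Space, ∫ a in Ioi (0 : ℝ), Φ p a ∂volume ∂(volume.prod volume) := by
    rw [Measure.volume_eq_prod, ← integral_const_mul]
    refine integral_congr_ae ?_
    filter_upwards [ae_fst_ne_snd] with p hp
    simp only [Φ]
    rw [integral_const_mul, integral_complex_ofReal, (integral_gaussKernel_Ioi hp).2]
    push_cast
    ring
  rw [h1, integral_integral_swap hΦ, ← integral_complex_ofReal]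
  refine setIntegral_congr_fun measurableSet_Ioi fun a ha => ?_
  simp only [Φ]
  rw [integral_exp_mul_normSq_fourier hfi ha]
  rfl

theorem lintegral_exp_neg_mul_Ioi {c : ℝ} (hc : 0 < c) :
    ∫⁻ a in Ioi (0 : ℝ), ENNReal.ofReal (Real.exp (-a * c)) = ENNReal.ofReal c⁻¹ := by
  have e : ∀ a : ℝ, Real.exp (-a * c) = Real.exp (-c * a) := fun a => by congr 1; ring
  simp_rw [e]
  rw [← ofReal_integral_eq_lintegral_ofReal
    (integrableOn_exp_mul_Ioi (by linarith) 0) (Eventually.of_forall fun a => (Real.exp_pos _).le),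
    integral_exp_mul_Ioi (by linarith) 0]
  congr 1
  simp

/-- After exchanging the integrals, ∫ exp(-a‖k‖²) da = ‖k‖⁻² supplies the Fourier multiplier of the
potential. -/
theorem ofReal_newton_energy_le {f : Space → ℂ} (hf : Continuous f) (hfc : HasCompactSupport f) :
    ENNReal.ofReal (Real.pi *
      (∫ p : Space × Space, conj (f p.1) * f p.2 * (‖p.1 - p.2‖⁻¹ : ℝ)).re) ≤
      ∫⁻ k : Space, ENNReal.ofReal (‖k‖ ^ 2)⁻¹ * ‖𝓕 f k‖ₑ ^ 2 := by
  have hfi : Integrable f := hf.integrable_of_hasCompactSupport hfc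
  have hm : Measurable fun k => ‖𝓕 f k‖ₑ ^ 2 :=
    (continuous_fourier hfi).measurable.enorm.pow_const 2
  rw [← Complex.re_ofReal_mul, pi_mul_integral_newton_pairing hf hfc, Complex.ofReal_re]
  calc ENNReal.ofReal (∫ a in Ioi (0 : ℝ), ∫ k : Space, Real.exp (-a * ‖k‖ ^ 2) * ‖𝓕 f k‖ ^ 2)
      ≤ ∫⁻ a in Ioi (0 : ℝ), ENNReal.ofReal
          (∫ k : Space, Real.exp (-a * ‖k‖ ^ 2) * ‖𝓕 f k‖ ^ 2) := by
        rw [← Real.enorm_of_nonneg (setIntegral_nonneg measurableSet_Ioi fun a _ =>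
          integral_nonneg fun k => by positivity)]
        refine (enorm_integral_le_lintegral_enorm _).trans_eq (lintegral_congr fun a => ?_)
        exact Real.enorm_of_nonneg (integral_nonneg fun k => by positivity)
    _ = ∫⁻ a in Ioi (0 : ℝ), ∫⁻ k : Space,
          ENNReal.ofReal (Real.exp (-a * ‖k‖ ^ 2)) * ‖𝓕 f k‖ₑ ^ 2 :=
        setLIntegral_congr_fun measurableSet_Ioi fun a ha =>
          ofReal_integral_exp_mul_normSq_fourier hfi ha
    _ = ∫⁻ k : Space, ∫⁻ a in Ioi (0 : ℝ),
          ENNReal.ofReal (Real.exp (-a * ‖k‖ ^ 2)) * ‖𝓕 f k‖ₑ ^ 2 := by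
        refine lintegral_lintegral_swap (Measurable.aemeasurable ?_)
        exact (by fun_prop : Measurable fun q : ℝ × Space =>
          Real.exp (-q.1 * ‖q.2‖ ^ 2)).ennreal_ofReal.mul (hm.comp measurable_snd)
    _ = ∫⁻ k : Space, ENNReal.ofReal (‖k‖ ^ 2)⁻¹ * ‖𝓕 f k‖ₑ ^ 2 := by
        refine lintegral_congr_ae ?_
        -- At k = 0 the integral over a diverges while the inverse of 0 is 0, so this point is
        -- discarded.
        filter_upwards [(compl_mem_ae_iff.2 (measure_singleton (0 : Space)))] with k hk
        have hk' : 0 < ‖k‖ := norm_pos_iff.2 hk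
        rw [lintegral_mul_const' _ _ (by simp), lintegral_exp_neg_mul_Ioi (by positivity)]

theorem fourier_partialDeriv {f : Space → ℂ} (hf : ContDiff ℝ 1 f) (hc : HasCompactSupport f)
    (i : Fin 3) (k : Space) :
    𝓕 (partialDeriv i f) k = 2 * Real.pi * Complex.I * k i * 𝓕 f k := by
  have hfi : Integrable f := hf.continuous.integrable_of_hasCompactSupport hc
  have hf' : Integrable (fderiv ℝ f) :=
    (hf.continuous_fderiv one_ne_zero).integrable_of_hasCompactSupport (hc.fderiv ℝ)
  have h := congrFun (Real.fourier_fderiv hfi (hf.differentiable (by simp)) hf') k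
  have h2 := congrArg (fun L : Space →L[ℝ] ℂ => L (EuclideanSpace.single i 1)) h
  simp only [Real.fourier_continuousLinearMap_apply hf'] at h2
  unfold partialDeriv
  have h3 : innerSL ℝ k (EuclideanSpace.single i 1) = k i := by
    rw [innerSL_apply_apply, EuclideanSpace.inner_single_right]
    simp
  rw [h2]
  simp [VectorFourier.fourierSMulRight_apply, h3]
  ring

theorem contDiff_cdiv {n : WithTop ℕ∞} {v : Space → CVec} (hv : ContDiff ℝ (n + 1) v) :
    ContDiff ℝ n (cdiv v) := by
  unfold cdiv partialDeriv
  refine ContDiff.sum fun i _ => ?_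
  have h : ContDiff ℝ (n + 1) fun y => v y i :=
    (contDiff_piLp (p := 2)).1 hv i
  exact (h.fderiv_right le_rfl).clm_apply contDiff_const

theorem hasCompactSupport_apply {v : Space → CVec} (hc : HasCompactSupport v) (i : Fin 3) :
    HasCompactSupport fun y => v y i :=
  hc.comp_left (g := fun w : CVec => w i) rfl

theorem tsupport_apply_subset (v : Space → CVec) (i : Fin 3) :
    tsupport (fun y => v y i) ⊆ tsupport v :=
  closure_mono fun x hx => by
    rw [Function.mem_support] at hx ⊢
    intro h
    exact hx (by rw [h]; rfl)

theorem partialDeriv_eq_zero_of_notMem_tsupport {F : Type*} [NormedAddCommGroup F]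
    [NormedSpace ℝ F] {f : Space → F} {x : Space} (hx : x ∉ tsupport f) (i : Fin 3) :
    partialDeriv i f x = 0 := by
  rw [partialDeriv, fderiv_of_notMem_tsupport ℝ hx]
  rfl

theorem cdiv_eq_zero_of_notMem_tsupport {v : Space → CVec} {x : Space} (hx : x ∉ tsupport v) :
    cdiv v x = 0 :=
  Finset.sum_eq_zero fun i _ =>
    partialDeriv_eq_zero_of_notMem_tsupport (fun h => hx (tsupport_apply_subset v i h)) i

theorem support_cdiv_subset (v : Space → CVec) : Function.support (cdiv v) ⊆ tsupport v := by
  intro x hx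
  by_contra h
  exact hx (cdiv_eq_zero_of_notMem_tsupport h)

theorem hasCompactSupport_cdiv {v : Space → CVec} (hc : HasCompactSupport v) :
    HasCompactSupport (cdiv v) :=
  hc.of_isClosed_subset (isClosed_tsupport _)
    (closure_minimal (support_cdiv_subset v) (isClosed_tsupport v))

/-- The transform of the divergence is 2πi k·v̂(k), to which Cauchy–Schwarz applies. The factor ‖k‖²
will cancel the multiplier of the potential. -/
theorem enorm_fourier_cdiv_sq_le {v : Space → CVec} (hv : ContDiff ℝ 1 v)
    (hc : HasCompactSupport v) (k : Space) :
    ‖𝓕 (cdiv v) k‖ₑ ^ 2 ≤ ENNReal.ofReal ((2 * Real.pi) ^ 2) * ENNReal.ofReal (‖k‖ ^ 2) *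
      ∑ i, ‖𝓕 (fun y => v y i) k‖ₑ ^ 2 := by
  have hvi : ∀ i, ContDiff ℝ 1 fun y => v y i := fun i => (contDiff_piLp (p := 2)).1 hv i
  have h1 : 𝓕 (cdiv v) k = ∑ i, 2 * Real.pi * Complex.I * k i * 𝓕 (fun y => v y i) k := by
    simp_rw [← fourier_partialDeriv (hvi _) (hasCompactSupport_apply hc _)]
    have hint : ∀ i, Integrable (partialDeriv i fun y => v y i) := fun i => by
      refine Continuous.integrable_of_hasCompactSupport ?_
        ((hasCompactSupport_apply hc i).fderiv_apply ℝ _)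
      exact ((hvi i).continuous_fderiv one_ne_zero).clm_apply continuous_const
    simp only [Real.fourier_eq, cdiv, Finset.smul_sum]
    rw [integral_finsetSum]
    exact fun i _ => by simpa using hint i
  have h2 : ‖𝓕 (cdiv v) k‖ ^ 2 ≤
      (2 * Real.pi) ^ 2 * ‖k‖ ^ 2 * ∑ i, ‖𝓕 (fun y => v y i) k‖ ^ 2 := by
    have h3 : ‖𝓕 (cdiv v) k‖ ≤ 2 * Real.pi * ∑ i, |k i| * ‖𝓕 (fun y => v y i) k‖ := by
      rw [h1, Finset.mul_sum]
      refine (norm_sum_le _ _).trans_eq (Finset.sum_congr rfl fun i _ => ?_)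
      simp [abs_of_pos Real.pi_pos]
      ring
    have h4 : (∑ i, |k i| * ‖𝓕 (fun y => v y i) k‖) ^ 2 ≤
        ‖k‖ ^ 2 * ∑ i, ‖𝓕 (fun y => v y i) k‖ ^ 2 := by
      have := Finset.sum_mul_sq_le_sq_mul_sq Finset.univ (fun i => |k i|)
        (fun i => ‖𝓕 (fun y => v y i) k‖)
      rw [EuclideanSpace.norm_sq_eq]
      simpa using this
    calc ‖𝓕 (cdiv v) k‖ ^ 2 ≤ (2 * Real.pi * ∑ i, |k i| * ‖𝓕 (fun y => v y i) k‖) ^ 2 := by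
          gcongr
      _ = (2 * Real.pi) ^ 2 * (∑ i, |k i| * ‖𝓕 (fun y => v y i) k‖) ^ 2 := by ring
      _ ≤ (2 * Real.pi) ^ 2 * (‖k‖ ^ 2 * ∑ i, ‖𝓕 (fun y => v y i) k‖ ^ 2) := by gcongr
      _ = _ := by ring
  have h5 := ENNReal.ofReal_le_ofReal h2
  rw [ENNReal.ofReal_mul (by positivity), ENNReal.ofReal_mul (by positivity),
    ENNReal.ofReal_sum_of_nonneg (fun i _ => by positivity)] at h5
  simpa only [ENNReal.ofReal_pow (norm_nonneg _), ofReal_norm] using h5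

/-- The Newtonian energy of a divergence is bounded by the `L²` norm of the field. -/
theorem re_integral_conj_cdiv_mul_newton_le {v : Space → CVec} (hv : ContDiff ℝ 1 v)
    (hc : HasCompactSupport v) :
    (∫ x, conj (cdiv v x) * newton (cdiv v) x).re ≤ ∫ x, ‖v x‖ ^ 2 := by
  have hdc : Continuous (cdiv v) := (contDiff_cdiv (n := 0) (by simpa using hv)).continuous
  have hds := hasCompactSupport_cdiv hc
  have hvi : ∀ i, Integrable fun y => v y i := fun i =>
    Continuous.integrable_of_hasCompactSupport ((contDiff_piLp (p := 2)).1 hv i).continuous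
      (hasCompactSupport_apply hc i)
  set Q := (∫ p : Space × Space, conj (cdiv v p.1) * cdiv v p.2 * (‖p.1 - p.2‖⁻¹ : ℝ)).re with hQ
  have h1 : (∫ x, conj (cdiv v x) * newton (cdiv v) x).re = (4 * Real.pi)⁻¹ * Q := by
    rw [integral_conj_mul_newton hdc hds hdc hds, Complex.re_ofReal_mul]
  have hv2 : Integrable fun x => ‖v x‖ ^ 2 := by
    refine Continuous.integrable_of_hasCompactSupport (by have := hv.continuous; fun_prop) ?_
    exact hc.comp_left (g := fun w : CVec => ‖w‖ ^ 2) (by simp)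
  have h2 : ENNReal.ofReal (Real.pi * Q) ≤
      ENNReal.ofReal ((2 * Real.pi) ^ 2 * ∫ x, ‖v x‖ ^ 2) := by
    calc ENNReal.ofReal (Real.pi * Q)
        ≤ ∫⁻ k : Space, ENNReal.ofReal (‖k‖ ^ 2)⁻¹ * ‖𝓕 (cdiv v) k‖ₑ ^ 2 :=
          ofReal_newton_energy_le hdc hds
      _ ≤ ∫⁻ k : Space, ENNReal.ofReal ((2 * Real.pi) ^ 2) *
            ∑ i, ‖𝓕 (fun y => v y i) k‖ₑ ^ 2 := by
          refine lintegral_mono fun k => ?_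
          calc ENNReal.ofReal (‖k‖ ^ 2)⁻¹ * ‖𝓕 (cdiv v) k‖ₑ ^ 2
              ≤ ENNReal.ofReal (‖k‖ ^ 2)⁻¹ * (ENNReal.ofReal ((2 * Real.pi) ^ 2) *
                  ENNReal.ofReal (‖k‖ ^ 2) * ∑ i, ‖𝓕 (fun y => v y i) k‖ₑ ^ 2) := by
                gcongr
                exact enorm_fourier_cdiv_sq_le hv hc k
            _ = ENNReal.ofReal ((‖k‖ ^ 2)⁻¹ * ‖k‖ ^ 2) * (ENNReal.ofReal ((2 * Real.pi) ^ 2) *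
                  ∑ i, ‖𝓕 (fun y => v y i) k‖ₑ ^ 2) := by
                rw [ENNReal.ofReal_mul (by positivity)]; ring
            -- An inequality rather than an equality, since the product is 0 at k = 0.
            _ ≤ 1 * _ := by
                gcongr
                rw [← ENNReal.ofReal_one]
                exact ENNReal.ofReal_le_ofReal inv_mul_le_one
            _ = _ := one_mul _
      _ = ENNReal.ofReal ((2 * Real.pi) ^ 2) *
            ∑ i, ∫⁻ k : Space, ‖𝓕 (fun y => v y i) k‖ₑ ^ 2 := by
          rw [lintegral_const_mul' _ _ (by simp), lintegral_finsetSum]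
          exact fun i _ => (continuous_fourier (hvi i)).measurable.enorm.pow_const 2
      _ ≤ ENNReal.ofReal ((2 * Real.pi) ^ 2) * ∑ i, ∫⁻ x : Space, ‖v x i‖ₑ ^ 2 := by
          exact mul_le_mul_right
            (Finset.sum_le_sum fun i _ => lintegral_enorm_fourier_sq_le (hvi i)) _
      _ = ENNReal.ofReal ((2 * Real.pi) ^ 2 * ∫ x, ‖v x‖ ^ 2) := by
          rw [ENNReal.ofReal_mul (by positivity), ofReal_integral_eq_lintegral_ofReal hv2
            (Eventually.of_forall fun x => by positivity), ← lintegral_finsetSum' _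
            fun i _ => (hvi i).1.enorm.pow_const 2]
          congr 2 with x
          rw [EuclideanSpace.norm_sq_eq, ENNReal.ofReal_sum_of_nonneg fun i _ => by positivity]
          simp only [ENNReal.ofReal_pow (norm_nonneg _), ofReal_norm]
  have h3 : Real.pi * Q ≤ (2 * Real.pi) ^ 2 * ∫ x, ‖v x‖ ^ 2 :=
    (ENNReal.ofReal_le_ofReal_iff
      (mul_nonneg (by positivity) (integral_nonneg fun x => by positivity))).1 h2
  rw [h1, inv_mul_le_iff₀ (by positivity)]
  have h4 : Real.pi * Q ≤ Real.pi * (4 * Real.pi * ∫ x, ‖v x‖ ^ 2) := by linarith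
  exact le_of_mul_le_mul_left h4 Real.pi_pos

end Newton

/-! ### The operator L on test fields. -/

section StellarOperator

open scoped ComplexConjugate

/-- Multiplying by a function that is `Cⁿ` on a neighborhood of the support keeps a `Cⁿ` function
`Cⁿ`. -/
theorem contDiff_smul_of_tsupport {E F 𝕜 : Type*} [NormedAddCommGroup E] [NormedSpace ℝ E]
    [NormedAddCommGroup F] [NormedSpace ℝ F] [NormedRing 𝕜] [NormedAlgebra ℝ 𝕜] [Module 𝕜 F]
    [IsBoundedSMul 𝕜 F] [IsScalarTower ℝ 𝕜 F] {n : WithTop ℕ∞} {a : E → 𝕜} {f : E → F}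
    (ha : ∀ x ∈ tsupport f, ContDiffAt ℝ n a x) (hf : ContDiff ℝ n f) :
    ContDiff ℝ n fun x => a x • f x := by
  rw [contDiff_iff_contDiffAt]
  intro x
  by_cases hx : x ∈ tsupport f
  · exact (ha x hx).smul hf.contDiffAt
  · refine (contDiffAt_const (c := (0 : F))).congr_of_eventuallyEq ?_
    filter_upwards [(isClosed_tsupport f).isOpen_compl.mem_nhds hx] with y hy
    rw [image_eq_zero_of_notMem_tsupport hy, smul_zero]

theorem integral_inner_cgrad {g : Space → ℂ} {v : Space → CVec} (hg : ContDiff ℝ 1 g)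
    (hv : ContDiff ℝ 1 v) (hc : HasCompactSupport v) :
    ∫ x, ⟪cgrad g x, v x⟫_ℂ = -∫ x, conj (g x) * cdiv v x := by
  have hvi : ∀ i, ContDiff ℝ 1 fun y => v y i := fun i => (contDiff_piLp (p := 2)).1 hv i
  have hci : ∀ i, HasCompactSupport fun y => v y i := fun i => hasCompactSupport_apply hc i
  have hgc : ContDiff ℝ 1 fun x => conj (g x) := Complex.conjCLE.contDiff.comp hg
  have hpd : ∀ i x, fderiv ℝ (fun x => conj (g x)) x (EuclideanSpace.single i 1) =
      conj (partialDeriv i g x) := by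
    intro i x
    have h := (Complex.conjCLE.hasFDerivAt (x := g x)).comp x
      (hg.differentiable (by simp) x).hasFDerivAt
    have h2 : fderiv ℝ (fun x => conj (g x)) x = _ := h.fderiv
    rw [h2]
    rfl
  have hcont : ∀ {f : Space → ℂ}, ContDiff ℝ 1 f → ∀ i : Fin 3,
      Continuous fun x => fderiv ℝ f x (EuclideanSpace.single i 1) := fun hf i =>
    (hf.continuous_fderiv one_ne_zero).clm_apply continuous_const
  have hibp : ∀ i, ∫ x, conj (partialDeriv i g x) * v x i =
      -∫ x, conj (g x) * partialDeriv i (fun y => v y i) x := by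
    intro i
    have h := integral_mul_fderiv_eq_neg_fderiv_mul_of_integrable (μ := (volume : Measure Space))
      (f := fun x => conj (g x)) (g := fun y => v y i) (v := EuclideanSpace.single i 1)
      (Continuous.integrable_of_hasCompactSupport ((hcont hgc i).mul (hvi i).continuous)
        (hci i).mul_left)
      (Continuous.integrable_of_hasCompactSupport (hgc.continuous.mul (hcont (hvi i) i))
        ((hci i).fderiv_apply ℝ _).mul_left)
      (Continuous.integrable_of_hasCompactSupport (hgc.continuous.mul (hvi i).continuous)
        (hci i).mul_left)
      (fun x _ => hgc.differentiable (by simp) x) (fun x _ => (hvi i).differentiable (by simp) x)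
    simp only [hpd] at h
    unfold partialDeriv at h ⊢
    rw [h, neg_neg]
  have h1 : ∀ i, Integrable fun x => conj (partialDeriv i g x) * v x i := fun i =>
    Continuous.integrable_of_hasCompactSupport
      ((Complex.continuous_conj.comp (hcont hg i)).mul (hvi i).continuous) (hci i).mul_left
  have h2 : ∀ i, Integrable fun x => conj (g x) * partialDeriv i (fun y => v y i) x := fun i =>
    Continuous.integrable_of_hasCompactSupport (hgc.continuous.mul (hcont (hvi i) i))
        ((hci i).fderiv_apply ℝ _).mul_left
  have e1 : ∀ x, ⟪cgrad g x, v x⟫_ℂ = ∑ i, conj (partialDeriv i g x) * v x i := fun x => by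
    rw [PiLp.inner_apply]
    exact Finset.sum_congr rfl fun i _ => by rw [RCLike.inner_apply, mul_comm]; rfl
  simp_rw [e1, cdiv, Finset.mul_sum]
  rw [integral_finsetSum _ fun i _ => h1 i, integral_finsetSum _ fun i _ => h2 i,
    ← Finset.sum_neg_distrib]
  exact Finset.sum_congr rfl fun i _ => hibp i

theorem cdiv_add {v w : Space → CVec} (hv : ContDiff ℝ 1 v) (hw : ContDiff ℝ 1 w) :
    cdiv (fun y => v y + w y) = fun x => cdiv v x + cdiv w x := by
  ext x
  simp only [cdiv, partialDeriv, ← Finset.sum_add_distrib]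
  refine Finset.sum_congr rfl fun i _ => ?_
  have h1 := ((contDiff_piLp (p := 2)).1 hv i).differentiable one_ne_zero x
  have h2 := ((contDiff_piLp (p := 2)).1 hw i).differentiable one_ne_zero x
  have h3 := fderiv_fun_add h1 h2
  simp only [PiLp.add_apply]
  rw [h3]
  rfl

theorem partialDeriv_const_mul {f : Space → ℂ} (hf : ContDiff ℝ 1 f) (c : ℂ) (i : Fin 3)
    (x : Space) : partialDeriv i (fun y => c * f y) x = c * partialDeriv i f x := by
  unfold partialDeriv
  rw [fderiv_const_mul (hf.differentiable one_ne_zero x)]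
  rfl

theorem cdiv_const_smul {v : Space → CVec} (hv : ContDiff ℝ 1 v) (c : ℂ) :
    cdiv (fun y => c • v y) = fun x => c * cdiv v x := by
  ext x
  simp only [cdiv, Finset.mul_sum]
  refine Finset.sum_congr rfl fun i _ => ?_
  rw [← partialDeriv_const_mul ((contDiff_piLp (p := 2)).1 hv i)]
  rfl

theorem cgrad_add {f g : Space → ℂ} (hf : ContDiff ℝ 1 f) (hg : ContDiff ℝ 1 g) :
    cgrad (fun y => f y + g y) = fun x => cgrad f x + cgrad g x := by
  ext x i
  simp only [cgrad, partialDeriv, PiLp.add_apply]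
  rw [fderiv_fun_add (hf.differentiable one_ne_zero x) (hg.differentiable one_ne_zero x)]
  rfl

theorem cgrad_const_mul {f : Space → ℂ} (hf : ContDiff ℝ 1 f) (c : ℂ) :
    cgrad (fun y => c * f y) = fun x => c • cgrad f x := by
  ext x i
  exact partialDeriv_const_mul hf c i x

theorem continuous_cgrad {f : Space → ℂ} (hf : ContDiff ℝ 1 f) : Continuous (cgrad f) := by
  refine (PiLp.continuous_toLp 2 _).comp (continuous_pi fun i => ?_)
  exact (hf.continuous_fderiv one_ne_zero).clm_apply continuous_const

theorem newton_add {f g : Space → ℂ} (hf : Continuous f) (hfc : HasCompactSupport f)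
    (hg : Continuous g) (hgc : HasCompactSupport g) :
    newton (fun y => f y + g y) = fun x => newton f x + newton g x := by
  ext x
  simp only [newton, smul_add]
  rw [integral_add (integrable_newton_kernel hf hfc x) (integrable_newton_kernel hg hgc x),
    smul_add]

theorem newton_const_mul (f : Space → ℂ) (c : ℂ) :
    newton (fun y => c * f y) = fun x => c * newton f x := by
  ext x
  have h : ∀ y, ‖x - y‖⁻¹ • (c * f y) = c * (‖x - y‖⁻¹ • f y) := fun y =>
    (mul_smul_comm _ _ _).symm
  simp only [newton, h]
  rw [integral_const_mul, mul_smul_comm]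

/-- The potential whose gradient is `L ξ`. -/
noncomputable def stellarPotential (P : ℝ → ℝ) (G : ℝ) (ρ : Space → ℝ) (ξ : Space → CVec) (x : Space) : ℂ :=
  -(((1 / ρ x) * deriv P (ρ x) : ℝ) : ℂ) * cdiv (fun y => ρ y • ξ y) x
    + ((4 * Real.pi * G : ℝ) : ℂ) * newton (cdiv fun y => ρ y • ξ y) x

theorem stellarL_eq_cgrad (P : ℝ → ℝ) (G : ℝ) (ρ : Space → ℝ) (ξ : Space → CVec) :
    stellarL P G ρ ξ = cgrad (stellarPotential P G ρ ξ) := rfl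

variable {P : ℝ → ℝ} {A γ : ℝ} {Λ : ℝ → ℝ} {G : ℝ} {u : ℝ → ℝ} {ρ : Space → ℝ} {R α : ℝ}

theorem hasCompactSupport_flux (ρ : Space → ℝ) (ξ : TestFunction (openBall R) CVec ⊤) :
    HasCompactSupport fun y => ρ y • ξ y :=
  ξ.hasCompactSupport.mono (Function.support_smul_subset_right ρ ξ)

theorem tsupport_flux_subset (ρ : Space → ℝ) (ξ : TestFunction (openBall R) CVec ⊤) :
    tsupport (fun y => ρ y • ξ y) ⊆ openBall R :=
  (closure_mono (Function.support_smul_subset_right ρ ξ)).trans ξ.tsupport_subset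

/-- The density need not be C² across the boundary, but ξ vanishes near it. From here the orders
count down: the flux is C², its divergence and the potential are C¹, and Lξ is continuous. -/
theorem contDiff_flux (hP : BarotropicLaw P A γ Λ) (hS : SphericalEquilibrium P G u ρ R α)
    (ξ : TestFunction (openBall R) CVec ⊤) : ContDiff ℝ 2 fun y => ρ y • ξ y :=
  contDiff_smul_of_tsupport (fun _ hx => hS.contDiffAt_density hP (ξ.tsupport_subset hx))
    (ξ.contDiff.of_le (WithTop.coe_le_coe.2 le_top))

theorem contDiff_cdiv_flux (hP : BarotropicLaw P A γ Λ) (hS : SphericalEquilibrium P G u ρ R α)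
    (ξ : TestFunction (openBall R) CVec ⊤) : ContDiff ℝ 1 (cdiv fun y => ρ y • ξ y) :=
  contDiff_cdiv (by simpa [one_add_one_eq_two] using contDiff_flux hP hS ξ)

theorem contDiff_soundSpeed_mul (hP : BarotropicLaw P A γ Λ)
    (hS : SphericalEquilibrium P G u ρ R α) (ξ : TestFunction (openBall R) CVec ⊤) :
    ContDiff ℝ 1 fun x =>
      (((1 / ρ x) * deriv P (ρ x) : ℝ) : ℂ) * cdiv (fun y => ρ y • ξ y) x := by
  refine contDiff_smul_of_tsupport (𝕜 := ℂ) (fun x hx => ?_) (contDiff_cdiv_flux hP hS ξ)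
  have hx' : x ∈ openBall R := tsupport_flux_subset ρ ξ
    (closure_minimal (support_cdiv_subset _) (isClosed_tsupport _) hx)
  have hρ : ContDiffAt ℝ 1 ρ x := (hS.contDiffAt_density hP hx').of_le (by norm_num)
  have hpos := hS.density_pos hx'
  have h1 : ContDiffAt ℝ 1 (fun x => deriv P (ρ x)) x :=
    ((hP.contDiffOn_deriv.contDiffAt (Ioi_mem_nhds hpos)).of_le (by simp)).comp x hρ
  exact Complex.ofRealCLM.contDiff.contDiffAt.comp x
    ((contDiffAt_const.div hρ hpos.ne').mul h1)

theorem contDiff_stellarPotential (hP : BarotropicLaw P A γ Λ)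
    (hS : SphericalEquilibrium P G u ρ R α) (ξ : TestFunction (openBall R) CVec ⊤) :
    ContDiff ℝ 1 (stellarPotential P G ρ ξ) := by
  have h1 := (contDiff_soundSpeed_mul hP hS ξ).neg
  have h2 := contDiff_newton (n := 1) (contDiff_cdiv_flux hP hS ξ)
    (hasCompactSupport_cdiv (hasCompactSupport_flux ρ ξ))
  have h3 := h1.add (contDiff_const (c := ((4 * Real.pi * G : ℝ) : ℂ)) |>.mul h2)
  convert! h3 using 1
  funext x
  simp only [stellarPotential]
  ring

theorem continuous_stellarL (hP : BarotropicLaw P A γ Λ)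
    (hS : SphericalEquilibrium P G u ρ R α) (ξ : TestFunction (openBall R) CVec ⊤) :
    Continuous (stellarL P G ρ ξ) :=
  continuous_cgrad (contDiff_stellarPotential hP hS ξ)

theorem stellarL_add (hP : BarotropicLaw P A γ Λ) (hS : SphericalEquilibrium P G u ρ R α)
    (ξ η : TestFunction (openBall R) CVec ⊤) :
    stellarL P G ρ (ξ + η : TestFunction (openBall R) CVec ⊤) =
      stellarL P G ρ ξ + stellarL P G ρ η := by
  have hD : cdiv (fun y => ρ y • (ξ + η : TestFunction (openBall R) CVec ⊤) y) =
      fun x => cdiv (fun y => ρ y • ξ y) x + cdiv (fun y => ρ y • η y) x := by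
    rw [← cdiv_add ((contDiff_flux hP hS ξ).of_le (by norm_num))
      ((contDiff_flux hP hS η).of_le (by norm_num))]
    congr 1 with y : 1
    exact smul_add _ _ _
  have hpot : stellarPotential P G ρ (ξ + η : TestFunction (openBall R) CVec ⊤) =
      fun x => stellarPotential P G ρ ξ x + stellarPotential P G ρ η x := by
    ext x
    simp only [stellarPotential]
    rw [hD, newton_add (contDiff_cdiv_flux hP hS ξ).continuous
      (hasCompactSupport_cdiv (hasCompactSupport_flux ρ ξ)) (contDiff_cdiv_flux hP hS η).continuous
      (hasCompactSupport_cdiv (hasCompactSupport_flux ρ η))]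
    ring
  rw [stellarL_eq_cgrad, hpot,
    cgrad_add (contDiff_stellarPotential hP hS ξ) (contDiff_stellarPotential hP hS η)]
  rfl

theorem stellarL_const_smul (hP : BarotropicLaw P A γ Λ) (hS : SphericalEquilibrium P G u ρ R α)
    (c : ℂ) (ξ : TestFunction (openBall R) CVec ⊤) :
    stellarL P G ρ (c • ξ : TestFunction (openBall R) CVec ⊤) = c • stellarL P G ρ ξ := by
  have hD : cdiv (fun y => ρ y • (c • ξ : TestFunction (openBall R) CVec ⊤) y) =
      fun x => c * cdiv (fun y => ρ y • ξ y) x := by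
    rw [← cdiv_const_smul ((contDiff_flux hP hS ξ).of_le (by norm_num))]
    congr 1 with y : 1
    exact smul_comm (ρ y) c (ξ y)
  have hpot : stellarPotential P G ρ (c • ξ : TestFunction (openBall R) CVec ⊤) =
      fun x => c * stellarPotential P G ρ ξ x := by
    ext x
    simp only [stellarPotential]
    rw [hD, newton_const_mul]
    ring
  rw [stellarL_eq_cgrad, hpot, cgrad_const_mul (contDiff_stellarPotential hP hS ξ)]
  rfl

/-! ### Realization of L in the weighted space. -/

theorem ae_weightedMeasure_iff (hP : BarotropicLaw P A γ Λ)
    (hS : SphericalEquilibrium P G u ρ R α) {p : Space → Prop} :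
    (∀ᵐ x ∂weightedMeasure ρ R, p x) ↔
      ∀ᵐ x ∂volume.restrict (openBall R : Set Space), p x := by
  rw [weightedMeasure, ae_withDensity_iff (hS.measurable_density hP).ennreal_ofReal]
  refine ⟨fun h => ?_, fun h => h.mono fun x hx _ => hx⟩
  filter_upwards [h, ae_restrict_mem (openBall R).isOpen.measurableSet] with x hx hxR
  exact hx (by simpa using hS.density_pos hxR)

theorem isFiniteMeasure_weightedMeasure (hP : BarotropicLaw P A γ Λ)
    (hS : SphericalEquilibrium P G u ρ R α) : IsFiniteMeasure (weightedMeasure ρ R) := by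
  refine isFiniteMeasure_withDensity (ne_top_of_le_ne_top ?_
    (lintegral_mono fun x => ENNReal.ofReal_le_ofReal (hS.density_le hP x)))
  rw [lintegral_const, Measure.restrict_apply_univ]
  exact ENNReal.mul_ne_top ENNReal.ofReal_ne_top measure_ball_lt_top.ne

theorem integral_weightedMeasure (hP : BarotropicLaw P A γ Λ)
    (hS : SphericalEquilibrium P G u ρ R α) {F : Type*} [NormedAddCommGroup F] [NormedSpace ℝ F]
    (f : Space → F) : ∫ x, f x ∂weightedMeasure ρ R = ∫ x, ρ x • f x := by
  rw [weightedMeasure, integral_withDensity_eq_integral_toReal_smul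
    (hS.measurable_density hP).ennreal_ofReal (by simp)]
  simp_rw [ENNReal.toReal_ofReal (hS.density_nonneg _)]
  refine setIntegral_eq_integral_of_forall_compl_eq_zero fun x hx => ?_
  rw [hS.density_eq_zero hx, zero_smul]

/-- Lξ need not have compact support, because 𝒦 is nonlocal; boundedness on the closed ball and
finiteness of the measure are what is used. -/
theorem memLp_of_continuous (hP : BarotropicLaw P A γ Λ)
    (hS : SphericalEquilibrium P G u ρ R α) {f : Space → CVec} (hf : Continuous f) :
    MemLp f 2 (weightedMeasure ρ R) := by
  have := isFiniteMeasure_weightedMeasure hP hS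
  obtain ⟨C, hC⟩ := (isCompact_closedBall (0 : Space) R).exists_bound_of_continuousOn
    hf.continuousOn
  refine MemLp.of_bound hf.aestronglyMeasurable C ?_
  rw [ae_weightedMeasure_iff hP hS]
  filter_upwards [ae_restrict_mem (openBall R).isOpen.measurableSet] with x hx
  exact hC x (Metric.ball_subset_closedBall hx)

/-- The linear map `ξ ↦ (ξ, L ξ)`. -/
noncomputable def stellarGraphMap (hP : BarotropicLaw P A γ Λ) (hS : SphericalEquilibrium P G u ρ R α) :
    TestFunction (openBall R) CVec ⊤ →ₗ[ℂ] WeightedL2 ρ R × WeightedL2 ρ R where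
  toFun ξ := ((memLp_of_continuous hP hS ξ.continuous).toLp ξ,
    (memLp_of_continuous hP hS (continuous_stellarL hP hS ξ)).toLp (stellarL P G ρ ξ))
  map_add' ξ η := by
    refine Prod.ext ?_ ?_
    · exact MemLp.toLp_add (memLp_of_continuous hP hS ξ.continuous)
        (memLp_of_continuous hP hS η.continuous)
    · simp only [stellarL_add hP hS]
      exact MemLp.toLp_add (memLp_of_continuous hP hS (continuous_stellarL hP hS ξ))
        (memLp_of_continuous hP hS (continuous_stellarL hP hS η))
  map_smul' c ξ := by
    refine Prod.ext ?_ ?_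
    · exact MemLp.toLp_const_smul c (memLp_of_continuous hP hS ξ.continuous)
    · simp only [stellarL_const_smul hP hS]
      exact MemLp.toLp_const_smul c (memLp_of_continuous hP hS (continuous_stellarL hP hS ξ))

theorem stellarGraphMap_eq_iff (hP : BarotropicLaw P A γ Λ)
    (hS : SphericalEquilibrium P G u ρ R α) (ξ : TestFunction (openBall R) CVec ⊤)
    (p : WeightedL2 ρ R × WeightedL2 ρ R) :
    stellarGraphMap hP hS ξ = p ↔
      p.1 =ᵐ[weightedMeasure ρ R] ξ ∧ p.2 =ᵐ[weightedMeasure ρ R] stellarL P G ρ ξ := by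
  have key : ∀ {f : Space → CVec} (hf : MemLp f 2 (weightedMeasure ρ R)) (q : WeightedL2 ρ R),
      hf.toLp f = q ↔ q =ᵐ[weightedMeasure ρ R] f := fun hf q =>
    ⟨fun h => h ▸ hf.coeFn_toLp, fun h => Lp.ext (hf.coeFn_toLp.trans h.symm)⟩
  rw [Prod.ext_iff]
  exact and_congr (key (memLp_of_continuous hP hS ξ.continuous) p.1)
    (key (memLp_of_continuous hP hS (continuous_stellarL hP hS ξ)) p.2)

/-- The weight is positive in the ball, so a continuous field is determined by its class. This makes
the range of `stellarGraphMap` the graph of an operator. -/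
theorem stellarGraphMap_fst_injective (hP : BarotropicLaw P A γ Λ)
    (hS : SphericalEquilibrium P G u ρ R α) {ξ : TestFunction (openBall R) CVec ⊤}
    (h : (stellarGraphMap hP hS ξ).1 = 0) : ξ = 0 := by
  have h1 : (ξ : Space → CVec) =ᵐ[weightedMeasure ρ R] 0 := by
    have h2 := ((stellarGraphMap_eq_iff hP hS ξ _).1 rfl).1
    rw [h] at h2
    exact h2.symm.trans (Lp.coeFn_zero _ _ _)
  have h3 := Measure.eqOn_open_of_ae_eq ((ae_weightedMeasure_iff hP hS).1 h1) (openBall R).isOpen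
    ξ.continuous.continuousOn continuousOn_const
  refine TestFunction.ext fun x => ?_
  by_cases hx : x ∈ openBall R
  · exact h3 hx
  · exact image_eq_zero_of_notMem_tsupport fun hx' => hx (ξ.tsupport_subset hx')

/-- The operator `L` with domain `C₀^∞(B_R; ℂ³)`. -/
noncomputable def stellarOperator (hP : BarotropicLaw P A γ Λ) (hS : SphericalEquilibrium P G u ρ R α) :
    WeightedL2 ρ R →ₗ.[ℂ] WeightedL2 ρ R :=
  (LinearMap.range (stellarGraphMap hP hS)).toLinearPMap

theorem stellarOperator_graph (hP : BarotropicLaw P A γ Λ)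
    (hS : SphericalEquilibrium P G u ρ R α) :
    (stellarOperator hP hS).graph = LinearMap.range (stellarGraphMap hP hS) := by
  refine Submodule.toLinearPMap_graph_eq _ ?_
  rintro _ ⟨ξ, rfl⟩ h
  rw [stellarGraphMap_fst_injective hP hS h, map_zero]
  rfl

theorem isStellarOperator_stellarOperator (hP : BarotropicLaw P A γ Λ)
    (hS : SphericalEquilibrium P G u ρ R α) :
    IsStellarOperator P G ρ R (stellarOperator hP hS) := by
  intro p
  rw [stellarOperator_graph]
  exact exists_congr fun ξ => stellarGraphMap_eq_iff hP hS ξ p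

theorem exists_stellarGraphMap_eq (hP : BarotropicLaw P A γ Λ)
    (hS : SphericalEquilibrium P G u ρ R α) (x : (stellarOperator hP hS).domain) :
    ∃ ξ, (stellarGraphMap hP hS ξ).1 = x ∧ (stellarGraphMap hP hS ξ).2 = stellarOperator hP hS x := by
  have h := (stellarOperator hP hS).mem_graph x
  rw [stellarOperator_graph] at h
  obtain ⟨ξ, hξ⟩ := h
  exact ⟨ξ, by rw [hξ], by rw [hξ]⟩

theorem stellarGraphMap_fst_mem_domain (hP : BarotropicLaw P A γ Λ)
    (hS : SphericalEquilibrium P G u ρ R α) (ξ : TestFunction (openBall R) CVec ⊤) :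
    (stellarGraphMap hP hS ξ).1 ∈ (stellarOperator hP hS).domain := by
  refine LinearPMap.mem_domain_of_mem_graph (y := (stellarGraphMap hP hS ξ).2) ?_
  rw [stellarOperator_graph]
  exact ⟨ξ, rfl⟩

/-! ### The quadratic form: symmetry, lower bound, density. -/

theorem inner_stellarGraphMap (hP : BarotropicLaw P A γ Λ)
    (hS : SphericalEquilibrium P G u ρ R α) (ξ η : TestFunction (openBall R) CVec ⊤) :
    ⟪(stellarGraphMap hP hS ξ).2, (stellarGraphMap hP hS η).1⟫_ℂ =
      (∫ x, (((1 / ρ x) * deriv P (ρ x) : ℝ) : ℂ) *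
        (conj (cdiv (fun y => ρ y • ξ y) x) * cdiv (fun y => ρ y • η y) x)) -
      ((4 * Real.pi * G : ℝ) : ℂ) *
        ∫ x, conj (cdiv (fun y => ρ y • ξ y) x) * newton (cdiv fun y => ρ y • η y) x := by
  have hDξ := (contDiff_cdiv_flux hP hS ξ).continuous
  have hDη := (contDiff_cdiv_flux hP hS η).continuous
  have hcξ := hasCompactSupport_cdiv (hasCompactSupport_flux ρ ξ)
  have hcη := hasCompactSupport_cdiv (hasCompactSupport_flux ρ η)
  have hN := (contDiff_newton (n := 1) (contDiff_cdiv_flux hP hS ξ) hcξ).continuous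
  have hs := (contDiff_soundSpeed_mul hP hS ξ).continuous
  rw [L2.inner_def]
  have e1 : ∫ x, ⟪(stellarGraphMap hP hS ξ).2 x, (stellarGraphMap hP hS η).1 x⟫_ℂ
      ∂weightedMeasure ρ R = ∫ x, ⟪stellarL P G ρ ξ x, η x⟫_ℂ ∂weightedMeasure ρ R := by
    refine integral_congr_ae ?_
    filter_upwards [((stellarGraphMap_eq_iff hP hS ξ _).1 rfl).2,
      ((stellarGraphMap_eq_iff hP hS η _).1 rfl).1] with x h1 h2
    rw [h1, h2]
  -- The weight turns η into the flux ρη, so that integration by parts yields div(ρη) and the form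
  -- becomes symmetric in ξ and η.
  have e2 : ∀ x, ρ x • ⟪stellarL P G ρ ξ x, η x⟫_ℂ =
      ⟪cgrad (stellarPotential P G ρ ξ) x, ρ x • η x⟫_ℂ := fun x => by
    rw [inner_smul_right_eq_smul]; rfl
  rw [e1, integral_weightedMeasure hP hS]
  simp_rw [e2]
  rw [integral_inner_cgrad (contDiff_stellarPotential hP hS ξ)
    ((contDiff_flux hP hS η).of_le (by norm_num)) (hasCompactSupport_flux ρ η),
    ← integral_conj_newton_mul hDξ hcξ hDη hcη, ← integral_const_mul, ← integral_sub,
    ← integral_neg]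
  · congr 1 with x
    simp only [stellarPotential, map_add, map_mul, map_neg, Complex.conj_ofReal]
    ring
  · have : Continuous fun x => conj ((((1 / ρ x) * deriv P (ρ x) : ℝ) : ℂ) *
        cdiv (fun y => ρ y • ξ y) x) * cdiv (fun y => ρ y • η y) x :=
      (Complex.continuous_conj.comp hs).mul hDη
    refine (this.integrable_of_hasCompactSupport hcη.mul_left).congr
      (Eventually.of_forall fun x => ?_)
    simp only [map_mul, Complex.conj_ofReal]
    ring
  · exact (((Complex.continuous_conj.comp hN).mul hDη).integrable_of_hasCompactSupport
      hcη.mul_left).const_mul _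

theorem isFormalAdjoint_stellarOperator (hP : BarotropicLaw P A γ Λ)
    (hS : SphericalEquilibrium P G u ρ R α) :
    (stellarOperator hP hS).IsFormalAdjoint (stellarOperator hP hS) := by
  intro x y
  obtain ⟨ξ, hξ1, hξ2⟩ := exists_stellarGraphMap_eq hP hS x
  obtain ⟨η, hη1, hη2⟩ := exists_stellarGraphMap_eq hP hS y
  rw [← hξ1, ← hξ2, ← hη1, ← hη2, ← inner_conj_symm (stellarGraphMap hP hS ξ).1,
    inner_stellarGraphMap, inner_stellarGraphMap, map_sub, map_mul, Complex.conj_ofReal,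
    ← integral_conj, ← integral_conj]
  have hDξ := (contDiff_cdiv_flux hP hS ξ).continuous
  have hDη := (contDiff_cdiv_flux hP hS η).continuous
  have hcξ := hasCompactSupport_cdiv (hasCompactSupport_flux ρ ξ)
  have hcη := hasCompactSupport_cdiv (hasCompactSupport_flux ρ η)
  congr 2
  · congr 1 with z
    simp only [map_mul, Complex.conj_ofReal, Complex.conj_conj]
    ring
  · rw [← integral_conj_newton_mul hDξ hcξ hDη hcη]
    congr 1 with z
    simp only [map_mul, Complex.conj_conj]
    ring

theorem isBoundedBelow_stellarOperator (hP : BarotropicLaw P A γ Λ) (hG : 0 < G)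
    (hS : SphericalEquilibrium P G u ρ R α) : IsBoundedBelow (stellarOperator hP hS) := by
  -- The gravitational term costs at most 4πG ∫ |ρξ|², and one factor ρ is estimated by ρ(0); the
  -- pressure term is nonnegative.
  refine ⟨4 * Real.pi * G * ρ 0, fun x => ?_⟩
  obtain ⟨ξ, hξ1, hξ2⟩ := exists_stellarGraphMap_eq hP hS x
  have hD := (contDiff_cdiv_flux hP hS ξ).continuous
  have hc := hasCompactSupport_flux ρ ξ
  rw [← hξ1, ← hξ2, inner_stellarGraphMap, Complex.sub_re, Complex.re_ofReal_mul]
  have h1 : 0 ≤ (∫ x, (((1 / ρ x) * deriv P (ρ x) : ℝ) : ℂ) *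
      (conj (cdiv (fun y => ρ y • ξ y) x) * cdiv (fun y => ρ y • ξ y) x)).re := by
    have e : ∀ x, (((1 / ρ x) * deriv P (ρ x) : ℝ) : ℂ) *
        (conj (cdiv (fun y => ρ y • ξ y) x) * cdiv (fun y => ρ y • ξ y) x) =
        (((1 / ρ x) * deriv P (ρ x) * ‖cdiv (fun y => ρ y • ξ y) x‖ ^ 2 : ℝ) : ℂ) := fun x => by
      rw [Complex.conj_mul']; push_cast; rfl
    simp_rw [e]
    rw [integral_complex_ofReal, Complex.ofReal_re]
    refine integral_nonneg fun x => ?_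
    by_cases hx : x ∈ openBall R
    · have h2 := hS.density_pos hx
      have h3 := hP.deriv_pos _ h2
      positivity
    · simp [hS.density_eq_zero hx]
  have h2 := re_integral_conj_cdiv_mul_newton_le ((contDiff_flux hP hS ξ).of_le (by norm_num)) hc
  have h3 : ‖(stellarGraphMap hP hS ξ).1‖ ^ 2 = ∫ x, ρ x * ‖ξ x‖ ^ 2 := by
    rw [← inner_self_eq_norm_sq (𝕜 := ℂ), L2.inner_def]
    have e : ∫ x, ⟪(stellarGraphMap hP hS ξ).1 x, (stellarGraphMap hP hS ξ).1 x⟫_ℂ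
        ∂weightedMeasure ρ R = ∫ x, ((‖ξ x‖ ^ 2 : ℝ) : ℂ) ∂weightedMeasure ρ R := by
      refine integral_congr_ae ?_
      filter_upwards [((stellarGraphMap_eq_iff hP hS ξ _).1 rfl).1] with x h1
      rw [h1, inner_self_eq_norm_sq_to_K]
      push_cast
      rfl
    rw [e, integral_complex_ofReal, integral_weightedMeasure hP hS]
    rfl
  have hξ2 : Integrable fun x => ‖ξ x‖ ^ 2 := by
    refine Continuous.integrable_of_hasCompactSupport (by have := ξ.continuous; fun_prop) ?_
    exact ξ.hasCompactSupport.comp_left (g := fun w : CVec => ‖w‖ ^ 2) (by simp)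
  have hρξ : Integrable fun x => ρ x * ‖ξ x‖ ^ 2 :=
    hξ2.bdd_mul (c := ρ 0) (hS.measurable_density hP).aestronglyMeasurable
      (Eventually.of_forall fun x => by
        rw [Real.norm_of_nonneg (hS.density_nonneg x)]; exact hS.density_le hP x)
  have h4 : ∫ x, ‖ρ x • ξ x‖ ^ 2 ≤ ρ 0 * ∫ x, ρ x * ‖ξ x‖ ^ 2 := by
    rw [← integral_const_mul]
    refine integral_mono_of_nonneg (Eventually.of_forall fun x => by positivity)
      (hρξ.const_mul _) (Eventually.of_forall fun x => ?_)
    have h5 := hS.density_nonneg x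
    have h6 := hS.density_le hP x
    simp only [norm_smul, Real.norm_of_nonneg h5, mul_pow]
    calc ρ x ^ 2 * ‖ξ x‖ ^ 2 = ρ x * (ρ x * ‖ξ x‖ ^ 2) := by ring
      _ ≤ ρ 0 * (ρ x * ‖ξ x‖ ^ 2) := by gcongr
  have h5 : 4 * Real.pi * G * (∫ x, conj (cdiv (fun y => ρ y • ξ y) x) *
      newton (cdiv fun y => ρ y • ξ y) x).re ≤
      4 * Real.pi * G * (ρ 0 * ‖(stellarGraphMap hP hS ξ).1‖ ^ 2) := by
    rw [h3]
    exact mul_le_mul_of_nonneg_left (h2.trans h4) (by positivity)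
  linarith

/-- A field f orthogonal to all φ eᵢ satisfies ρfᵢ = 0 almost everywhere in the ball by the
fundamental lemma of the calculus of variations, and ρ > 0 there. -/
theorem dense_domain_stellarOperator (hP : BarotropicLaw P A γ Λ)
    (hS : SphericalEquilibrium P G u ρ R α) :
    Dense ((stellarOperator hP hS).domain : Set (WeightedL2 ρ R)) := by
  have := isFiniteMeasure_weightedMeasure hP hS
  rw [Submodule.dense_iff_topologicalClosure_eq_top, Submodule.topologicalClosure_eq_top_iff,
    Submodule.eq_bot_iff]
  intro f hf
  have hfi : Integrable f (weightedMeasure ρ R) := (Lp.memLp f).integrable (by norm_num)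
  have hfi' : IntegrableOn (fun x => ρ x • f x) (openBall R) := by
    have h := (integrable_withDensity_iff_integrable_smul'
      (hS.measurable_density hP).ennreal_ofReal (by simp)).1 hfi
    simpa only [ENNReal.toReal_ofReal (hS.density_nonneg _)] using! h
  have hcomp : ∀ i, ∀ᵐ x, x ∈ (openBall R : Set Space) → (ρ x • f x) i = 0 := by
    intro i
    have hint : IntegrableOn (fun x => (ρ x • f x) i) (openBall R) :=
      (EuclideanSpace.proj (𝕜 := ℂ) i).integrable_comp hfi'
    refine (openBall R).isOpen.ae_eq_zero_of_integral_contDiff_smul_eq_zero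
      hint.locallyIntegrableOn fun φ hφ hφc hφs => ?_
    let ξ : TestFunction (openBall R) CVec ⊤ :=
      ⟨fun x => φ x • EuclideanSpace.single i (1 : ℂ), hφ.smul contDiff_const,
        hφc.smul_right,
        (closure_mono (Function.support_smul_subset_left _ _)).trans hφs⟩
    have h1 : ⟪(stellarGraphMap hP hS ξ).1, f⟫_ℂ = 0 :=
      hf _ (stellarGraphMap_fst_mem_domain hP hS ξ)
    rw [L2.inner_def] at h1
    have e1 : ∫ x, ⟪(stellarGraphMap hP hS ξ).1 x, f x⟫_ℂ ∂weightedMeasure ρ R =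
        ∫ x, φ x • f x i ∂weightedMeasure ρ R := by
      refine integral_congr_ae ?_
      filter_upwards [((stellarGraphMap_eq_iff hP hS ξ _).1 rfl).1] with x h2
      rw [h2]
      change ⟪φ x • EuclideanSpace.single i (1 : ℂ), f x⟫_ℂ = _
      rw [inner_smul_left_eq_smul, EuclideanSpace.inner_single_left]
      simp
    rw [e1, integral_weightedMeasure hP hS] at h1
    rw [← h1]
    congr 1 with x
    rw [smul_comm]
    rfl
  refine Lp.eq_zero_iff_ae_eq_zero.2 ?_
  change ∀ᵐ x ∂weightedMeasure ρ R, f x = 0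
  rw [ae_weightedMeasure_iff hP hS, ae_restrict_iff' (openBall R).isOpen.measurableSet]
  filter_upwards [ae_all_iff.2 hcomp] with x hx hxR
  have h1 : ρ x • f x = 0 := by
    ext i
    exact hx i hxR
  exact (smul_eq_zero.1 h1).resolve_left (hS.density_pos hxR).ne'

end StellarOperator

theorem theorem1 (P : ℝ → ℝ) (A γ : ℝ) (Λ : ℝ → ℝ) (hP : BarotropicLaw P A γ Λ)
    (G : ℝ) (hG : 0 < G) (u : ℝ → ℝ) (ρ : Space → ℝ) (R α : ℝ)
    (hS : SphericalEquilibrium P G u ρ R α) :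
    ∃ T : WeightedL2 ρ R →ₗ.[ℂ] WeightedL2 ρ R,
      IsStellarOperator P G ρ R T ∧
      Dense (T.domain : Set (WeightedL2 ρ R)) ∧
      T.IsFormalAdjoint T ∧
      IsBoundedBelow T ∧
      ∃ L : WeightedL2 ρ R →ₗ.[ℂ] WeightedL2 ρ R,
        IsFriedrichsExtension T L ∧ T ≤ L ∧ IsSelfAdjoint L ∧ IsBoundedBelow L := by
  have hd := dense_domain_stellarOperator hP hS
  have hs := isFormalAdjoint_stellarOperator hP hS
  have hb := isBoundedBelow_stellarOperator hP hG hS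
  exact ⟨stellarOperator hP hS, isStellarOperator_stellarOperator hP hS, hd, hs, hb,
    exists_isFriedrichsExtension hd hs hb⟩
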